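/- **Setting.** For $c,h\in\mathbb C$ let $V_{c,h}$ be the Verma module of the Virasoro algebra $[L_m,L_n]=(m-n)L_{m+n}+\frac c{12}m(m^2-1)\delta_{m+n,0}$, generated by $|h\rangle$ with $L_0|h\rangle=h|h\rangle$ and $L_n|h\rangle=0$ for $n>0$. For a partition $M=(m_1\ge\dots\ge m_k\ge1)$ of $n$ put $|h,M\rangle=L_{-m_1}\cdots L_{-m_k}|h\rangle$. Let $B_{M|N}=\langle h,M|N,h\rangle$ be the Gram matrix at level $n$ (for the bilinear form with $L_m^\dagger=L_{-m}$, $\langle h|h\rangle=1$), and let $B^{M|N}$ be its inverse. Let $\phi_\Delta$ be a primary field of dimension $\Delta$, i.e. $[L_m,\phi_\Delta(z)]=z^m(z\partial_z+(m+1)\Delta)\phi_\Delta(z)$ for all $m\in\mathbb Z$. The one-point torus block with exchanged dimension $h=\tilde\Delta$ is $$q^{c/24-h}\,\mathcal V(\Delta,h,c|q)=\sum_{n\ge0}q^n\,\mathcal V_n(\Delta,h,c),\qquad \mathcal V_n(\Delta,h,c)=\sum_{|M|=|N|=n}B^{M|N}\,\frac{\langle h,M|\phi_\Delta(z)|N,h\rangle}{\langle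 h|\phi_\Delta(z)|h\rangle}.$$ Power series in $q$ are formal and their limits are coefficientwise; $c\to\infty$ and $\tilde\Delta\to\infty$ mean $|c|\to\infty$ and $|\tilde\Delta|\to\infty$ in $\mathbb C$. The light block is $\mathcal L(\Delta,\tilde\Delta|q)=\lim_{c\to\infty}q^{c/24-\tilde\Delta}\mathcal V(\Delta,\tilde\Delta,c|q)$ with $\Delta,\tilde\Delta$ fixed. The heavy-light block is $\mathcal H(\Delta,\tilde\epsilon|q)=\lim_{c\to\infty}q^{c/24-\tilde\Delta}\mathcal V(\Delta,c\tilde\epsilon,c|q)$, where $\tilde\Delta=c\tilde\epsilon$, with $\Delta$ and $\tilde\epsilon$ fixed. **Proposition 4.1.** Let $\Delta\in\mathbb C$. 1. For every $n\ge0$ and every $\tilde\Delta\in\mathbb C$ with $2\tilde\Delta\notin\{0,-1,\dots,-(n-1)\}$, the level-$n$ Gram matrix at $(c,\tilde\Delta)$ is invertible for all sufficiently large $|c|$, and the limit defining the level-$n$ coefficient of $\mathcal L(\Delta,\tilde\Delta|q)$ exists. 2. Let $\tilde\epsilon\in\mathbb C$ with $\tilde\epsilon\ne-\frac{m^2-1}{24}$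 for all integers $m\ge1$. Then for every $n$ the level-$n$ Gram matrix at $(c,c\tilde\epsilon)$ is invertible for all sufficiently large $|c|$, the limit defining $\mathcal H(\Delta,\tilde\epsilon|q)$ exists, and $$\mathcal H(\Delta,\tilde\epsilon|q)=\lim_{\tilde\Delta\to\infty}\mathcal L(\Delta,\tilde\Delta|q)=\frac1{\varphi(q)},\qquad \varphi(q)=\prod_{n\ge1}(1-q^n).$$ In particular $\mathcal H$ does not depend on $\Delta$ or $\tilde\epsilon$. -/

import Mathlib

open Filter Topology Bornology PowerSeries
open scoped PowerSeries.WithPiTopology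

noncomputable section

namespace Virasoro

/-! ### The Virasoro algebra and its Verma modules -/

/-- The central term `(c / 12) m (m ^ 2 - 1) δ_{m + n, 0}`. -/
def central (c : ℂ) (m n : ℤ) : ℂ :=
  if m + n = 0 then c / 12 * (m * ((m : ℂ) ^ 2 - 1)) else 0

/-- For a family `L` of elements of an algebra, the difference of the two sides of the Virasoro
relation `[L_m, L_n] = (m - n) L_{m + n} + (c / 12) m (m ^ 2 - 1) δ_{m + n, 0}`. -/
def relator {A : Type*} [Ring A] [Algebra ℂ A] (c : ℂ) (L : ℤ → A) (m n : ℤ) : A :=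
  L m * L n - L n * L m - (((m : ℂ) - n) • L (m + n) + central c m n • (1 : A))

/-- The left ideal, in the free algebra on letters `L_n` (`n : ℤ`), generated by the Virasoro
relations at central charge `c`, by the `L_n` with `n > 0`, and by `L_0 - h`. -/
def vermaIdeal (c h : ℂ) : Submodule (FreeAlgebra ℂ ℤ) (FreeAlgebra ℂ ℤ) :=
  Submodule.span (FreeAlgebra ℂ ℤ)
    ({x | ∃ m n y, x = relator c (FreeAlgebra.ι ℂ) m n * y} ∪
     {x | ∃ n : ℤ, 0 < n ∧ x = FreeAlgebra.ι ℂ n} ∪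
     {FreeAlgebra.ι ℂ 0 - algebraMap ℂ _ h})

/-- The Verma module of central charge `c` and lowest weight (conformal dimension) `h`: the
universal module with a vector `|h⟩` such that `L_n |h⟩ = 0` for `n > 0`, `L_0 |h⟩ = h |h⟩`. -/
def Verma (c h : ℂ) : Type := FreeAlgebra ℂ ℤ ⧸ vermaIdeal c h

instance (c h : ℂ) : AddCommGroup (Verma c h) :=
  inferInstanceAs (AddCommGroup (FreeAlgebra ℂ ℤ ⧸ vermaIdeal c h))

instance (c h : ℂ) : Module (FreeAlgebra ℂ ℤ) (Verma c h) :=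
  inferInstanceAs (Module (FreeAlgebra ℂ ℤ) (FreeAlgebra ℂ ℤ ⧸ vermaIdeal c h))

instance (c h : ℂ) : Module ℂ (Verma c h) :=
  Module.compHom _ (algebraMap ℂ (FreeAlgebra ℂ ℤ))

instance (c h : ℂ) : IsScalarTower ℂ (FreeAlgebra ℂ ℤ) (Verma c h) :=
  IsScalarTower.of_algebraMap_smul fun _ _ => rfl

/-- The action of the Virasoro generator `L_n` on the Verma module. -/
def L (c h : ℂ) (n : ℤ) : Module.End ℂ (Verma c h) where
  toFun u := FreeAlgebra.ι ℂ n • u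
  map_add' u w := smul_add _ u w
  map_smul' a u := by
    rw [RingHom.id_apply, ← algebraMap_smul (FreeAlgebra ℂ ℤ) a u,
      ← algebraMap_smul (FreeAlgebra ℂ ℤ) a (FreeAlgebra.ι ℂ n • u), ← mul_smul, ← mul_smul,
      Algebra.commutes]

/-- The quotient map onto the Verma module. -/
def toVerma (c h : ℂ) : FreeAlgebra ℂ ℤ →ₗ[FreeAlgebra ℂ ℤ] Verma c h := (vermaIdeal c h).mkQ

/-- The primary state `|h⟩`. -/
def vac (c h : ℂ) : Verma c h := toVerma c h 1

theorem toVerma_surjective (c h : ℂ) : Function.Surjective (toVerma c h) :=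
  (vermaIdeal c h).mkQ_surjective

theorem toVerma_eq_zero (c h : ℂ) {x : FreeAlgebra ℂ ℤ} :
    toVerma c h x = 0 ↔ x ∈ vermaIdeal c h :=
  Submodule.Quotient.mk_eq_zero _

theorem toVerma_smul (c h a : ℂ) (x : FreeAlgebra ℂ ℤ) :
    toVerma c h (a • x) = a • toVerma c h x := by
  rw [← algebraMap_smul (FreeAlgebra ℂ ℤ) a x, map_smul, algebraMap_smul]

theorem L_toVerma (c h : ℂ) (n : ℤ) (x : FreeAlgebra ℂ ℤ) :
    L c h n (toVerma c h x) = toVerma c h (FreeAlgebra.ι ℂ n * x) := rfl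

/-- A linear map on the free algebra that kills the defining left ideal descends to the Verma
module. -/
theorem exists_factor (c h : ℂ) {X : Type*} [AddCommGroup X] [Module ℂ X]
    (ev : FreeAlgebra ℂ ℤ →ₗ[ℂ] X) (hev : ∀ x ∈ vermaIdeal c h, ev x = 0) :
    ∃ f : Verma c h →ₗ[ℂ] X, ∀ x, f (toVerma c h x) = ev x := by
  let π : FreeAlgebra ℂ ℤ →ₗ[ℂ] Verma c h :=
    { toFun := toVerma c h
      map_add' := map_add _
      map_smul' := toVerma_smul c h }
  have hker : LinearMap.ker π ≤ LinearMap.ker ev := fun x hx =>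
    hev x ((toVerma_eq_zero c h).1 hx)
  let e := π.quotKerEquivOfSurjective (toVerma_surjective c h)
  refine ⟨(LinearMap.ker π).liftQ ev hker ∘ₗ e.symm.toLinearMap, fun x => ?_⟩
  have : e.symm (toVerma c h x) = (LinearMap.ker π).mkQ x := by
    rw [LinearEquiv.symm_apply_eq]; rfl
  rw [LinearMap.comp_apply, LinearEquiv.coe_coe, this]
  rfl

theorem L_pos_vac (c h : ℂ) {n : ℤ} (hn : 0 < n) : L c h n (vac c h) = 0 := by
  rw [vac, L_toVerma, toVerma_eq_zero, mul_one]
  exact Submodule.subset_span (Or.inl (Or.inr ⟨n, hn, rfl⟩))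

theorem L_zero_vac (c h : ℂ) : L c h 0 (vac c h) = h • vac c h := by
  rw [vac, L_toVerma, ← toVerma_smul, ← sub_eq_zero, ← map_sub, toVerma_eq_zero, mul_one,
    ← Algebra.algebraMap_eq_smul_one]
  exact Submodule.subset_span (Or.inr rfl)

/-- The operators `L_n` on the Verma module satisfy the Virasoro relations. -/
theorem relator_L (c h : ℂ) (m n : ℤ) : relator c (L c h) m n = 0 := by
  apply LinearMap.ext
  intro u
  obtain ⟨x, rfl⟩ := toVerma_surjective c h u
  have key : toVerma c h (relator c (FreeAlgebra.ι ℂ) m n * x) = 0 := by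
    rw [toVerma_eq_zero]
    exact Submodule.subset_span (Or.inl (Or.inl ⟨m, n, x, rfl⟩))
  rw [LinearMap.zero_apply, ← key]
  simp only [relator, LinearMap.sub_apply, LinearMap.add_apply, LinearMap.smul_apply,
    Module.End.mul_apply, Module.End.one_apply, L_toVerma, sub_mul, add_mul, smul_mul_assoc,
    one_mul, mul_assoc, map_sub, map_add, toVerma_smul]

theorem central_swap (c : ℂ) (m n : ℤ) : central c m n = - central c n m := by
  unfold central
  by_cases hmn : m + n = 0
  · obtain rfl : n = -m := by omega
    simp
  · rw [if_neg hmn, if_neg (by omega)]; simp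

theorem relator_swap {A : Type*} [Ring A] [Algebra ℂ A] (c : ℂ) (L : ℤ → A) (m n : ℤ) :
    relator c L m n = - relator c L n m := by
  unfold relator
  rw [central_swap c m n, add_comm m n]
  module

theorem central_jacobi (c : ℂ) (x y z : ℤ) :
    ((y : ℂ) - z) * central c x (y + z) + ((z : ℂ) - x) * central c y (z + x) +
      ((x : ℂ) - y) * central c z (x + y) = 0 := by
  unfold central
  by_cases hs : x + y + z = 0
  · obtain rfl : z = -x - y := by omega
    rw [if_pos (by ring), if_pos (by ring), if_pos (by ring)]
    push_cast
    ring
  · rw [if_neg (by omega), if_neg (by omega), if_neg (by omega)]; ring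

theorem relator_swap_eq_zero {A : Type*} [Ring A] [Algebra ℂ A] {c : ℂ} {L : ℤ → A} {m n : ℤ}
    (h : relator c L n m = 0) : relator c L m n = 0 := by
  rw [relator_swap, h, neg_zero]

/-- The Jacobi identity, in terms of the defects of the Virasoro relations. -/
theorem relator_jacobi {A : Type*} [Ring A] [Algebra ℂ A] (c : ℂ) (L : ℤ → A) (x y z : ℤ) :
    (L x * relator c L y z - relator c L y z * L x + ((y : ℂ) - z) • relator c L x (y + z)) +
    (L y * relator c L z x - relator c L z x * L y + ((z : ℂ) - x) • relator c L y (z + x)) +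
    (L z * relator c L x y - relator c L x y * L z + ((x : ℂ) - y) • relator c L z (x + y))
      = 0 := by
  have h1 : y + (z + x) = x + (y + z) := by ring
  have h2 : z + (x + y) = x + (y + z) := by ring
  have hj := congrArg (fun t : ℂ => t • (1 : A)) (central_jacobi c x y z)
  simp only [zero_smul] at hj
  rw [← neg_eq_zero, ← hj]
  simp only [relator, mul_sub, sub_mul, mul_add, add_mul, smul_mul_assoc, mul_smul_comm, mul_one,
    one_mul, smul_sub, smul_add, h1, h2, mul_assoc]
  push_cast
  module

/-! ### Freeness of the Verma module over the lowering operators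

An explicit model on words in the letters `L_{-1}, L_{-2}, …` (the list entry `a` stands for
`L_{-(a + 1)}`) is used to show that covariant maps out of the Verma module exist. -/

/-- The action of `L_k` on a word: lowering operators are prepended, the others are commuted to
the right until they reach the primary state. -/
def wordOp (c h : ℂ) : ℤ → List ℕ → (List ℕ →₀ ℂ)
  | k, [] => if k < 0 then Finsupp.single [(-k - 1).toNat] 1
      else if k = 0 then Finsupp.single [] h else 0
  | k, a :: w => if k < 0 then Finsupp.single ((-k - 1).toNat :: a :: w) 1
      else Finsupp.lmapDomain ℂ ℂ (List.cons a) (wordOp c h k w) +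
        (((k : ℂ) + (a + 1)) • wordOp c h (k - (a + 1)) w +
          central c k (-(a + 1)) • Finsupp.single w 1)

/-- The linear extension of `wordOp`. -/
def wordEnd (c h : ℂ) (k : ℤ) : Module.End ℂ (List ℕ →₀ ℂ) :=
  Finsupp.linearCombination ℂ (wordOp c h k)

theorem wordEnd_single (c h : ℂ) (k : ℤ) (w : List ℕ) :
    wordEnd c h k (Finsupp.single w 1) = wordOp c h k w := by
  simp [wordEnd]

theorem wordEnd_neg (c h : ℂ) (a : ℕ) :
    wordEnd c h (-(a + 1)) = Finsupp.lmapDomain ℂ ℂ (List.cons a) := by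
  apply Finsupp.lhom_ext'
  intro w
  ext1
  have hneg : (-((a : ℤ) + 1)) < 0 := by omega
  have hto : (-(-((a : ℤ) + 1)) - 1).toNat = a := by omega
  simp only [LinearMap.comp_apply, Finsupp.lsingle_apply]
  rw [wordEnd_single]
  cases w <;> simp only [wordOp, if_pos hneg, hto] <;> simp

theorem wordEnd_cons (c h : ℂ) (a : ℕ) (w : List ℕ) :
    wordEnd c h (-(a + 1)) (Finsupp.single w 1) = Finsupp.single (a :: w) 1 := by
  rw [wordEnd_neg]; simp

/-- The exact relations between raising (or `L_0`) and lowering operators on words. -/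
theorem wordEnd_mixed (c h : ℂ) {n b : ℤ} (hn : 0 ≤ n) (hb : b < 0) :
    relator c (wordEnd c h) n b = 0 := by
  obtain ⟨a, rfl⟩ : ∃ a : ℕ, b = -(a + 1) := ⟨(-b - 1).toNat, by omega⟩
  apply Finsupp.lhom_ext'
  intro w
  ext1
  have hn' : ¬ n < 0 := by omega
  simp only [LinearMap.comp_apply, Finsupp.lsingle_apply, relator, LinearMap.sub_apply,
    LinearMap.add_apply, LinearMap.smul_apply, Module.End.mul_apply, Module.End.one_apply,
    wordEnd_cons, LinearMap.zero_apply]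
  rw [wordEnd_single, wordEnd_single, wordEnd_single, wordEnd_neg]
  simp only [wordOp, if_neg hn']
  have e : n + -((a : ℤ) + 1) = n - (a + 1) := by ring
  rw [e, Finsupp.lmapDomain_apply]
  push_cast
  module

theorem relator_comm_of_mixed {A : Type*} [Ring A] [Algebra ℂ A] (c : ℂ) (L : ℤ → A)
    (x y z : ℤ) (h1 : relator c L y z = 0) (h2 : relator c L z x = 0)
    (h3 : relator c L z (x + y) = 0) :
    relator c L x y * L z = L z * relator c L x y + ((y : ℂ) - z) • relator c L x (y + z) +
      ((z : ℂ) - x) • relator c L y (z + x) := by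
  have J := relator_jacobi c L x y z
  rw [h1, h2, h3] at J
  simp only [mul_zero, zero_mul, sub_zero, zero_add, smul_zero, add_zero] at J
  rw [← sub_eq_zero, ← neg_eq_zero, ← J]
  abel

theorem wordEnd_raising (c h : ℂ) (w : List ℕ) : ∀ {m n : ℤ}, 0 ≤ m → 0 ≤ n →
    relator c (wordEnd c h) m n (Finsupp.single w 1) = 0 := by
  induction w with
  | nil =>
    intro m n hm hn
    have hvac : ∀ k : ℤ, 0 ≤ k → wordEnd c h k (Finsupp.single [] 1) =
        (if k = 0 then h else 0) • Finsupp.single [] 1 := by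
      intro k hk
      rw [wordEnd_single, wordOp, if_neg (by omega)]
      by_cases hk0 : k = 0 <;> simp [hk0]
    simp only [relator, LinearMap.sub_apply, LinearMap.add_apply, LinearMap.smul_apply,
      Module.End.mul_apply, Module.End.one_apply, hvac m hm, hvac n hn, map_smul,
      hvac (m + n) (by omega)]
    have hc : central c m n = 0 := by
      unfold central
      by_cases hs : m + n = 0
      · have : m = 0 := by omega
        simp [this]
      · simp [hs]
    rw [hc]
    by_cases hs : m + n = 0
    · have h1 : m = 0 := by omega
      have h2 : n = 0 := by omega
      simp [h1, h2]
    · rw [if_neg hs]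
      module
  | cons a w ih =>
    intro m n hm hn
    have hb : (-((a : ℤ) + 1)) < 0 := by omega
    have hmix : ∀ {x y : ℤ}, 0 ≤ x → relator c (wordEnd c h) x y (Finsupp.single w 1) = 0 := by
      intro x y hx
      by_cases hy : 0 ≤ y
      · exact ih hx hy
      · rw [wordEnd_mixed c h hx (by omega)]; rfl
    have J := relator_comm_of_mixed c (wordEnd c h) m n (-((a : ℤ) + 1))
      (wordEnd_mixed c h hn hb)
      (relator_swap_eq_zero (wordEnd_mixed c h hm hb))
      (relator_swap_eq_zero (wordEnd_mixed c h (by omega) hb))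
    have J' := congrArg (fun T : Module.End ℂ (List ℕ →₀ ℂ) => T (Finsupp.single w 1)) J
    simp only [Module.End.mul_apply, LinearMap.add_apply, LinearMap.smul_apply,
      wordEnd_cons] at J'
    rw [J', hmix hm, hmix hm, hmix hn]
    simp

theorem wordEnd_relator (c h : ℂ) {m n : ℤ} (hmn : 0 ≤ m ∨ 0 ≤ n) :
    relator c (wordEnd c h) m n = 0 := by
  by_cases hm : 0 ≤ m
  · by_cases hn : 0 ≤ n
    · apply Finsupp.lhom_ext'
      intro w
      ext1
      exact wordEnd_raising c h w hm hn
    · exact wordEnd_mixed c h hm (by omega)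
  · exact relator_swap_eq_zero (wordEnd_mixed c h (by omega) (by omega))

/-- The subspaces of the space of words that contain the relations between lowering operators and
are stable under the lowering operators. -/
def wordRelSet (c h : ℂ) : Set (Submodule ℂ (List ℕ →₀ ℂ)) :=
  {p | (∀ a b : ℤ, ∀ w, relator c (wordEnd c h) a b w ∈ p) ∧
    ∀ b : ℤ, b < 0 → ∀ w ∈ p, wordEnd c h b w ∈ p}

/-- The relations between lowering operators. -/
def wordRel (c h : ℂ) : Submodule ℂ (List ℕ →₀ ℂ) := sInf (wordRelSet c h)

theorem wordRel_mem (c h : ℂ) : wordRel c h ∈ wordRelSet c h := by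
  refine ⟨fun a b w => ?_, fun b hb w hw => ?_⟩
  · exact (Submodule.mem_sInf).2 fun p hp => hp.1 a b w
  · exact (Submodule.mem_sInf).2 fun p hp => hp.2 b hb w ((Submodule.mem_sInf).1 hw p hp)

theorem wordRel_stable (c h : ℂ) (n : ℤ) {w : List ℕ →₀ ℂ} (hw : w ∈ wordRel c h) :
    wordEnd c h n w ∈ wordRel c h := by
  by_cases hn0 : n < 0
  · exact (wordRel_mem c h).2 n hn0 w hw
  have hR := (wordRel_mem c h).1
  have hS := (wordRel_mem c h).2
  let J : Submodule ℂ (List ℕ →₀ ℂ) :=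
    wordRel c h ⊓ ⨅ k : {k : ℤ // 0 ≤ k}, (wordRel c h).comap (wordEnd c h k)
  have memJ : ∀ x, x ∈ J ↔ x ∈ wordRel c h ∧ ∀ k : ℤ, 0 ≤ k → wordEnd c h k x ∈ wordRel c h := by
    intro x
    simp [J, Submodule.mem_iInf]
  have hJ : J ∈ wordRelSet c h := by
    refine ⟨fun a b w => ?_, fun b hb w hw => ?_⟩
    · rw [memJ]
      refine ⟨hR a b w, fun k hk => ?_⟩
      have j := congrArg (fun T : Module.End ℂ (List ℕ →₀ ℂ) => T w)
        (relator_jacobi c (wordEnd c h) k a b)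
      by_cases hab : 0 ≤ a ∨ 0 ≤ b
      · rw [wordEnd_relator c h hab]; simp
      · push Not at hab
        rw [wordEnd_relator c h (m := b) (n := k) (Or.inr hk),
          wordEnd_relator c h (m := k) (n := a) (Or.inl hk),
          wordEnd_relator c h (m := k) (n := a + b) (Or.inl hk)] at j
        simp only [mul_zero, zero_mul, sub_zero, zero_add, smul_zero, add_zero,
          LinearMap.add_apply, LinearMap.sub_apply, LinearMap.smul_apply, Module.End.mul_apply,
          LinearMap.zero_apply] at j
        have e : wordEnd c h k (relator c (wordEnd c h) a b w) =
            relator c (wordEnd c h) a b (wordEnd c h k w) -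
              ((b : ℂ) - k) • relator c (wordEnd c h) a (b + k) w -
              ((k : ℂ) - a) • relator c (wordEnd c h) b (k + a) w := by
          rw [← sub_eq_zero, ← j]; abel
        rw [e]
        exact Submodule.sub_mem _ (Submodule.sub_mem _ (hR _ _ _)
          (Submodule.smul_mem _ _ (hR _ _ _))) (Submodule.smul_mem _ _ (hR _ _ _))
    · rw [memJ] at hw ⊢
      refine ⟨hS b hb w hw.1, fun k hk => ?_⟩
      have j := congrArg (fun T : Module.End ℂ (List ℕ →₀ ℂ) => T w)
        (wordEnd_mixed c h hk hb)
      simp only [relator, LinearMap.sub_apply, LinearMap.add_apply, LinearMap.smul_apply,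
        Module.End.mul_apply, Module.End.one_apply, LinearMap.zero_apply] at j
      have hall : ∀ k : ℤ, wordEnd c h k w ∈ wordRel c h := fun k => by
        by_cases hk' : k < 0
        · exact hS k hk' w hw.1
        · exact hw.2 k (by omega)
      have e : wordEnd c h k (wordEnd c h b w) = wordEnd c h b (wordEnd c h k w) +
          (((k : ℂ) - b) • wordEnd c h (k + b) w + central c k b • w) := by
        rw [← sub_eq_zero, ← j]; abel
      rw [e]
      exact Submodule.add_mem _ (hS b hb _ (hall k)) (Submodule.add_mem _
        (Submodule.smul_mem _ _ (hall _)) (Submodule.smul_mem _ _ hw.1))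
  have : w ∈ J := (Submodule.mem_sInf).1 hw J hJ
  exact ((memJ w).1 this).2 n (by omega)

/-- The Verma module is free on the primary state over the algebra of lowering operators. -/
theorem exists_covariant (c h : ℂ) {X : Type*} [AddCommGroup X] [Module ℂ X]
    (T : ℤ → Module.End ℂ X)
    (hT : ∀ a b : ℤ, a < 0 → b < 0 → T a * T b - T b * T a = ((a : ℂ) - b) • T (a + b))
    (x₀ : X) :
    ∃ f : Verma c h →ₗ[ℂ] X, f (vac c h) = x₀ ∧
      ∀ b : ℤ, b < 0 → ∀ w, f (L c h b w) = T b (f w) := by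
  let F : (List ℕ →₀ ℂ) →ₗ[ℂ] X :=
    Finsupp.linearCombination ℂ (fun w => w.foldr (fun a x => T (-(a + 1)) x) x₀)
  have hF : ∀ b : ℤ, b < 0 → F ∘ₗ wordEnd c h b = T b ∘ₗ F := by
    intro b hb
    obtain ⟨a, rfl⟩ : ∃ a : ℕ, b = -(a + 1) := ⟨(-b - 1).toNat, by omega⟩
    apply Finsupp.lhom_ext'
    intro w
    ext
    simp only [LinearMap.comp_apply, Finsupp.lsingle_apply, wordEnd_cons]
    simp [F]
  have hF' : ∀ b : ℤ, b < 0 → ∀ w, F (wordEnd c h b w) = T b (F w) := fun b hb w =>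
    LinearMap.congr_fun (hF b hb) w
  have hker : wordRel c h ≤ LinearMap.ker F := by
    refine sInf_le ⟨fun a b w => ?_, fun b hb w hw => ?_⟩
    · by_cases hab : 0 ≤ a ∨ 0 ≤ b
      · rw [wordEnd_relator c h hab]; simp
      · push Not at hab
        have hc : central c a b = 0 := by rw [central, if_neg (by omega)]
        have t := congrArg (fun S : Module.End ℂ X => S (F w)) (hT a b hab.1 hab.2)
        simp only [LinearMap.sub_apply, Module.End.mul_apply, LinearMap.smul_apply] at t
        simp only [LinearMap.mem_ker, relator, LinearMap.sub_apply, LinearMap.add_apply,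
          LinearMap.smul_apply, Module.End.mul_apply, hc, zero_smul, add_zero, map_sub, map_smul,
          hF' a hab.1, hF' b hab.2, hF' (a + b) (by omega), t, sub_self]
    · rw [LinearMap.mem_ker] at hw ⊢
      rw [hF' b hb, hw, map_zero]
  let act : FreeAlgebra ℂ ℤ →ₐ[ℂ] Module.End ℂ (List ℕ →₀ ℂ) := FreeAlgebra.lift ℂ (wordEnd c h)
  have hact : ∀ n, act (FreeAlgebra.ι ℂ n) = wordEnd c h n := fun n => by simp [act]
  have hstab : ∀ x : FreeAlgebra ℂ ℤ, ∀ w ∈ wordRel c h, act x w ∈ wordRel c h := by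
    intro x
    induction x using FreeAlgebra.induction with
    | grade0 r =>
      intro w hw
      rw [AlgHom.commutes, Module.algebraMap_end_apply]
      exact Submodule.smul_mem _ _ hw
    | grade1 n =>
      intro w hw
      rw [hact]
      exact wordRel_stable c h n hw
    | mul a b ha hb =>
      intro w hw
      rw [map_mul, Module.End.mul_apply]
      exact ha _ (hb _ hw)
    | add a b ha hb =>
      intro w hw
      rw [map_add, LinearMap.add_apply]
      exact Submodule.add_mem _ (ha _ hw) (hb _ hw)
  let e : List ℕ →₀ ℂ := Finsupp.single [] 1
  have hI : ∀ x ∈ vermaIdeal c h, act x e ∈ wordRel c h := by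
    intro x hx
    induction hx using Submodule.span_induction with
    | mem x hx =>
      rcases hx with (⟨m, n, y, rfl⟩ | ⟨n, hn, rfl⟩) | hx
      · have hr : act (relator c (FreeAlgebra.ι ℂ) m n) = relator c (wordEnd c h) m n := by
          simp [relator, hact]
        rw [map_mul, Module.End.mul_apply, hr]
        exact (wordRel_mem c h).1 m n _
      · rw [hact]
        have : wordEnd c h n e = 0 := by
          simp only [e]
          rw [wordEnd_single, wordOp, if_neg (by omega), if_neg (by omega)]
        rw [this]
        exact Submodule.zero_mem _
      · rw [Set.mem_singleton_iff.1 hx]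
        have : act (FreeAlgebra.ι ℂ 0 - algebraMap ℂ _ h) e = 0 := by
          rw [map_sub, hact, AlgHom.commutes, LinearMap.sub_apply, Module.algebraMap_end_apply]
          simp only [e]
          rw [wordEnd_single, wordOp]
          simp
        rw [this]
        exact Submodule.zero_mem _
    | zero => simp
    | add x y _ _ hx hy =>
      rw [map_add, LinearMap.add_apply]
      exact Submodule.add_mem _ hx hy
    | smul a x _ hx =>
      rw [smul_eq_mul, map_mul, Module.End.mul_apply]
      exact hstab a _ hx
  let ev : FreeAlgebra ℂ ℤ →ₗ[ℂ] X := F ∘ₗ (LinearMap.applyₗ e) ∘ₗ act.toLinearMap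
  have hev : ∀ x, ev x = F (act x e) := fun x => rfl
  obtain ⟨f, hf⟩ := exists_factor c h ev (fun x hx => hker (hI x hx))
  refine ⟨f, ?_, ?_⟩
  · rw [vac, hf, hev, map_one]
    simp [e, F]
  · intro b hb w
    obtain ⟨x, rfl⟩ := toVerma_surjective c h w
    rw [L_toVerma, hf, hf, hev, hev, map_mul, Module.End.mul_apply, hact, hF' b hb]

/-- The universal property of the Verma module. -/
theorem exists_lift (c h : ℂ) {V : Type*} [AddCommGroup V] [Module ℂ V] (A : ℤ → Module.End ℂ V)
    (hA : ∀ m n, relator c A m n = 0) (x₀ : V) (hpos : ∀ n : ℤ, 0 < n → A n x₀ = 0)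
    (hzero : A 0 x₀ = h • x₀) :
    ∃ g : Verma c h →ₗ[ℂ] V, g (vac c h) = x₀ ∧ ∀ m w, g (L c h m w) = A m (g w) := by
  let act : FreeAlgebra ℂ ℤ →ₐ[ℂ] Module.End ℂ V := FreeAlgebra.lift ℂ A
  have hact : ∀ n, act (FreeAlgebra.ι ℂ n) = A n := fun n => by simp [act]
  have hI : ∀ x ∈ vermaIdeal c h, act x x₀ = 0 := by
    intro x hx
    induction hx using Submodule.span_induction with
    | mem x hx =>
      rcases hx with (⟨m, n, y, rfl⟩ | ⟨n, hn, rfl⟩) | hx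
      · have hr : act (relator c (FreeAlgebra.ι ℂ) m n) = relator c A m n := by
          simp [relator, hact]
        rw [map_mul, Module.End.mul_apply, hr, hA]; rfl
      · rw [hact, hpos n hn]
      · rw [Set.mem_singleton_iff.1 hx, map_sub, hact, AlgHom.commutes, LinearMap.sub_apply,
          Module.algebraMap_end_apply, hzero, sub_self]
    | zero => simp
    | add x y _ _ hx hy => rw [map_add, LinearMap.add_apply, hx, hy, add_zero]
    | smul a x _ hx => rw [smul_eq_mul, map_mul, Module.End.mul_apply, hx, map_zero]
  let ev : FreeAlgebra ℂ ℤ →ₗ[ℂ] V := (LinearMap.applyₗ x₀) ∘ₗ act.toLinearMap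
  have hev : ∀ x, ev x = act x x₀ := fun x => rfl
  obtain ⟨g, hg⟩ := exists_factor c h ev hI
  refine ⟨g, ?_, ?_⟩
  · rw [vac, hg, hev, map_one]; rfl
  · intro m w
    obtain ⟨x, rfl⟩ := toVerma_surjective c h w
    rw [L_toVerma, hg, hg, hev, hev, map_mul, Module.End.mul_apply, hact]

/-- The Verma module is spanned by the vectors `L_{-m_1} … L_{-m_k} |h⟩`. -/
theorem verma_induction (c h : ℂ) (P : Submodule ℂ (Verma c h)) (h0 : vac c h ∈ P)
    (hP : ∀ b : ℤ, b < 0 → ∀ w ∈ P, L c h b w ∈ P) (w : Verma c h) : w ∈ P := by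
  let C : Set (Submodule ℂ (Verma c h)) :=
    {p | vac c h ∈ p ∧ ∀ b : ℤ, b < 0 → ∀ w ∈ p, L c h b w ∈ p}
  let Q : Submodule ℂ (Verma c h) := sInf C
  have hQ0 : vac c h ∈ Q := (Submodule.mem_sInf).2 fun p hp => hp.1
  have hQ : ∀ b : ℤ, b < 0 → ∀ w ∈ Q, L c h b w ∈ Q := fun b hb w hw =>
    (Submodule.mem_sInf).2 fun p hp => hp.2 b hb w ((Submodule.mem_sInf).1 hw p hp)
  let J : Submodule ℂ (Verma c h) := Q ⊓ ⨅ k : ℤ, Q.comap (L c h k)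
  have memJ : ∀ x, x ∈ J ↔ x ∈ Q ∧ ∀ k : ℤ, L c h k x ∈ Q := by
    intro x
    simp [J, Submodule.mem_iInf]
  have hJ : J ∈ C := by
    refine ⟨(memJ _).2 ⟨hQ0, fun k => ?_⟩, fun b hb w hw => ?_⟩
    · rcases lt_trichotomy k 0 with hk | rfl | hk
      · exact hQ k hk _ hQ0
      · rw [L_zero_vac]; exact Submodule.smul_mem _ _ hQ0
      · rw [L_pos_vac c h hk]; exact Submodule.zero_mem _
    · rw [memJ] at hw ⊢
      refine ⟨hw.2 b, fun k => ?_⟩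
      have j := congrArg (fun T : Module.End ℂ (Verma c h) => T w) (relator_L c h k b)
      simp only [relator, LinearMap.sub_apply, LinearMap.add_apply, LinearMap.smul_apply,
        Module.End.mul_apply, Module.End.one_apply, LinearMap.zero_apply] at j
      have e : L c h k (L c h b w) = L c h b (L c h k w) +
          (((k : ℂ) - b) • L c h (k + b) w + central c k b • w) := by
        rw [← sub_eq_zero, ← j]; abel
      rw [e]
      exact Submodule.add_mem _ (hQ b hb _ (hw.2 k)) (Submodule.add_mem _
        (Submodule.smul_mem _ _ (hw.2 _)) (Submodule.smul_mem _ _ hw.1))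
  have hQs : ∀ k : ℤ, ∀ x ∈ Q, L c h k x ∈ Q := fun k x hx =>
    ((memJ x).1 ((Submodule.mem_sInf).1 hx J hJ)).2 k
  have hx : ∀ x : FreeAlgebra ℂ ℤ, ∀ u ∈ Q, x • u ∈ Q := by
    intro x
    induction x using FreeAlgebra.induction with
    | grade0 r =>
      intro u hu
      rw [algebraMap_smul]
      exact Submodule.smul_mem _ _ hu
    | grade1 n => exact fun u hu => hQs n u hu
    | mul a b ha hb => intro u hu; rw [mul_smul]; exact ha _ (hb _ hu)
    | add a b ha hb => intro u hu; rw [add_smul]; exact Submodule.add_mem _ (ha _ hu) (hb _ hu)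
  obtain ⟨x, rfl⟩ := toVerma_surjective c h w
  have := hx x _ hQ0
  rw [vac, ← map_smul, smul_eq_mul, mul_one] at this
  exact (Submodule.mem_sInf).1 this P ⟨h0, hP⟩

/-! ### Covariant forms: the Gram form and the matrix elements of a primary field -/

/-- `IsWardForm c h D x₀ ρ`: the pairing `ρ u w = ⟨u| φ |w⟩` of states of the Verma module, with
values in `X`, satisfies `⟨u| [L_m, φ] |w⟩ = D_m ⟨u| φ |w⟩` for all `m`, where the conjugation
rule is `L_m† = L_{-m}`, that is `⟨u| L_m = ⟨L_{-m} u|`; and `⟨h| φ |h⟩ = x₀`. -/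
def IsWardForm (c h : ℂ) {X : Type*} [AddCommGroup X] [Module ℂ X] (D : ℤ → Module.End ℂ X)
    (x₀ : X) (ρ : Verma c h →ₗ[ℂ] Verma c h →ₗ[ℂ] X) : Prop :=
  ρ (vac c h) (vac c h) = x₀ ∧
    ∀ (m : ℤ) (u w : Verma c h), ρ (L c h (-m) u) w = ρ u (L c h m w) + D m (ρ u w)

theorem existsUnique_wardForm (c h : ℂ) {X : Type*} [AddCommGroup X] [Module ℂ X]
    (D : ℤ → Module.End ℂ X)
    (hD : ∀ m n : ℤ, D m * D n - D n * D m = ((n : ℂ) - m) • D (m + n))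
    (x₀ : X) (hx₀ : D 0 x₀ = 0) :
    ∃! ρ : Verma c h →ₗ[ℂ] Verma c h →ₗ[ℂ] X, IsWardForm c h D x₀ ρ := by
  obtain ⟨f, hf0, hf⟩ := exists_covariant c h (fun b => -D b) (by
    intro a b _ _
    have := hD a b
    simp only [neg_mul_neg, this]
    module) x₀
  have hfL0 : ∀ w, f (L c h 0 w) + D 0 (f w) = h • f w := by
    intro w
    have hw : w ∈ LinearMap.ker (f ∘ₗ L c h 0 + D 0 ∘ₗ f - h • f) := by
      refine verma_induction c h _ ?_ ?_ w
      · simp [L_zero_vac, hf0, hx₀]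
      · intro b hb w hw
        simp only [LinearMap.mem_ker, LinearMap.sub_apply, LinearMap.add_apply,
          LinearMap.comp_apply, LinearMap.smul_apply] at hw ⊢
        have j := congrArg (fun T : Module.End ℂ (Verma c h) => f (T w)) (relator_L c h 0 b)
        have d := congrArg (fun T : Module.End ℂ X => T (f w)) (hD 0 b)
        have hc : central c 0 b = 0 := by simp [central]
        simp only [relator, LinearMap.sub_apply, LinearMap.add_apply, LinearMap.smul_apply,
          Module.End.mul_apply, Module.End.one_apply, LinearMap.zero_apply, hc, zero_smul, add_zero,
          map_sub, map_smul, map_zero, zero_add, hf b hb, LinearMap.neg_apply] at j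
        simp only [LinearMap.sub_apply, Module.End.mul_apply, LinearMap.smul_apply, zero_add] at d
        have hw' := congrArg (D b) hw
        simp only [map_sub, map_add, map_smul, map_zero] at hw'
        rw [hf b hb, LinearMap.neg_apply, map_neg]
        have j2 : f (L c h 0 (L c h b w)) =
            -(D b) (f (L c h 0 w)) + (((0 : ℤ) : ℂ) - b) • (-(D b) (f w)) := by
          rw [← sub_eq_zero, ← j]; abel
        have d2 : D 0 (D b (f w)) = D b (D 0 (f w)) + ((b : ℂ) - ((0 : ℤ) : ℂ)) • D b (f w) := by
          rw [← sub_eq_zero, ← sub_eq_zero.2 d]; abel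
        have h2 : D b (f (L c h 0 w)) = h • D b (f w) - D b (D 0 (f w)) := by
          rw [← sub_eq_zero, ← hw']; abel
        rw [j2, d2, h2]
        module
    simpa [sub_eq_zero] using hw
  let A : ℤ → Module.End ℂ (Verma c h →ₗ[ℂ] X) := fun m =>
    (LinearMap.lcomp ℂ X (L c h (-m)) : (Verma c h →ₗ[ℂ] X) →ₗ[ℂ] (Verma c h →ₗ[ℂ] X)) +
      LinearMap.llcomp ℂ (Verma c h) X X (D (-m))
  have hAapp : ∀ m g w, A m g w = g (L c h (-m) w) + D (-m) (g w) := fun m g w => rfl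
  obtain ⟨ρ, hρ0, hρ⟩ := exists_lift c h A (by
    intro m n
    apply LinearMap.ext
    intro g
    apply LinearMap.ext
    intro w
    have j := congrArg (fun T : Module.End ℂ (Verma c h) => g (T w)) (relator_L c h (-n) (-m))
    have d := congrArg (fun T : Module.End ℂ X => T (g w)) (hD (-m) (-n))
    have hc : central c (-n) (-m) = central c m n := by
      unfold central
      by_cases hs : m + n = 0
      · obtain rfl : n = -m := by omega
        simp
      · rw [if_neg hs, if_neg (by omega)]
    have e1 : -(m + n) = -n + -m := by ring
    have e2 : -m + -n = -n + -m := by ring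
    simp only [relator, LinearMap.sub_apply, LinearMap.add_apply, LinearMap.smul_apply,
      Module.End.mul_apply, Module.End.one_apply, LinearMap.zero_apply, map_sub, map_add,
      map_smul, map_zero, hc] at j
    simp only [LinearMap.sub_apply, Module.End.mul_apply, LinearMap.smul_apply, e2] at d
    simp only [relator, LinearMap.sub_apply, LinearMap.add_apply, LinearMap.smul_apply,
      Module.End.mul_apply, Module.End.one_apply, LinearMap.zero_apply, hAapp, map_add, e1]
    have d' := sub_eq_zero.2 d
    have s := congrArg₂ (· + ·) j d'
    simp only [add_zero] at s
    rw [← s]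
    push_cast
    module) f (by
      intro n hn
      apply LinearMap.ext
      intro w
      rw [hAapp, hf (-n) (by omega)]
      simp) (by
      apply LinearMap.ext
      intro w
      rw [hAapp]
      simpa using hfL0 w)
  refine ⟨ρ, ⟨by rw [hρ0, hf0], fun m u w => ?_⟩, fun σ hσ => ?_⟩
  · rw [hρ, hAapp, neg_neg]
  · have hσv : ∀ w, σ (vac c h) w = f w := by
      intro w
      have := verma_induction c h (LinearMap.ker (σ (vac c h) - f))
        (by simp [hσ.1, hf0]) (by
          intro b hb w hw
          simp only [LinearMap.mem_ker, LinearMap.sub_apply, sub_eq_zero] at hw ⊢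
          have := hσ.2 b (vac c h) w
          rw [L_pos_vac c h (by omega), map_zero, LinearMap.zero_apply] at this
          rw [hf b hb, LinearMap.neg_apply, ← hw]
          exact eq_neg_of_add_eq_zero_left this.symm) w
      simpa [sub_eq_zero] using this
    apply LinearMap.ext
    intro u
    have := verma_induction c h (LinearMap.ker (σ - ρ))
      (by
        rw [LinearMap.mem_ker, LinearMap.sub_apply, sub_eq_zero, hρ0]
        exact LinearMap.ext hσv) (by
        intro b hb u hu
        rw [LinearMap.mem_ker, LinearMap.sub_apply, sub_eq_zero] at hu ⊢
        apply LinearMap.ext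
        intro w
        have h1 := hσ.2 (-b) u w
        rw [neg_neg] at h1
        rw [h1, hρ, hAapp, hu]) u
    simpa [sub_eq_zero] using this

/-- The Gram (Shapovalov) form `⟨u | w⟩` on the Verma module: the unique bilinear form with
`⟨h | h⟩ = 1` and `L_m† = L_{-m}`. -/
def gramForm (c h : ℂ) : Verma c h →ₗ[ℂ] Verma c h →ₗ[ℂ] ℂ :=
  (existsUnique_wardForm c h (X := ℂ) (fun _ => 0) (by intro m n; simp) 1 (by simp)).choose

theorem gramForm_spec (c h : ℂ) : IsWardForm c h (fun _ => 0) (1 : ℂ) (gramForm c h) :=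
  (existsUnique_wardForm c h (X := ℂ) (fun _ => 0) (by intro m n; simp) 1 (by simp)).choose_spec.1

/-- The operator `z ^ m (z ∂_z + (m + 1) Δ)` on functions `z ^ (-Δ) p(z)` with `p` a Laurent
polynomial, written in terms of `p`: since `z ∂_z` acts on `z ^ (k - Δ)` as `k - Δ`, it sends
`z ^ k` to `(k + m Δ) z ^ (k + m)`. The Laurent polynomial `∑ a_k z ^ k` is encoded by the
finitely supported function `k ↦ a_k`. -/
def fieldOp (Δ : ℂ) (m : ℤ) : Module.End ℂ (ℤ →₀ ℂ) :=
  Finsupp.linearCombination ℂ fun k => Finsupp.single (k + m) ((k : ℂ) + m * Δ)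

theorem fieldOp_single (Δ : ℂ) (m k : ℤ) (a : ℂ) :
    fieldOp Δ m (Finsupp.single k a) = Finsupp.single (k + m) (a * ((k : ℂ) + m * Δ)) := by
  rw [fieldOp, Finsupp.linearCombination_single, Finsupp.smul_single, smul_eq_mul]

theorem fieldOp_comm (Δ : ℂ) (m n : ℤ) :
    fieldOp Δ m * fieldOp Δ n - fieldOp Δ n * fieldOp Δ m =
      ((n : ℂ) - m) • fieldOp Δ (m + n) := by
  apply Finsupp.lhom_ext
  intro k a
  simp only [LinearMap.sub_apply, Module.End.mul_apply, LinearMap.smul_apply, fieldOp_single,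
    Finsupp.smul_single, smul_eq_mul]
  rw [show k + n + m = k + (m + n) by ring, show k + m + n = k + (m + n) by ring,
    ← Finsupp.single_sub]
  congr 1
  push_cast
  ring

/-- The normalised matrix elements `⟨u| φ_Δ(z) |w⟩ / ⟨h| φ_Δ(z) |h⟩` of the primary field `φ_Δ`
between states of the Verma module, as Laurent polynomials in `z`
(here `⟨h| φ_Δ(z) |h⟩` is proportional to `z ^ (-Δ)`). They are the unique solution
of `[L_m, φ_Δ] = z ^ m (z ∂_z + (m + 1) Δ) φ_Δ`, `m ∈ ℤ`. -/
def primaryForm (Δ c h : ℂ) : Verma c h →ₗ[ℂ] Verma c h →ₗ[ℂ] (ℤ →₀ ℂ) :=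
  (existsUnique_wardForm c h (fieldOp Δ) (fieldOp_comm Δ) (Finsupp.single 0 1)
    (by simp [fieldOp_single])).choose

theorem primaryForm_spec (Δ c h : ℂ) :
    IsWardForm c h (fieldOp Δ) (Finsupp.single 0 1) (primaryForm Δ c h) :=
  (existsUnique_wardForm c h (fieldOp Δ) (fieldOp_comm Δ) (Finsupp.single 0 1)
    (by simp [fieldOp_single])).choose_spec.1

/-! ### The one-point torus block -/

/-- The state `L_{-m_1} ⋯ L_{-m_k} |h⟩` attached to a list `[m_1, …, m_k]`. -/
def descendant (c h : ℂ) (l : List ℕ) : Verma c h :=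
  l.foldr (fun m u => L c h (-(m : ℤ)) u) (vac c h)

/-- The basis monomial `|h, M⟩ = L_{-m_1} ⋯ L_{-m_k} |h⟩`, `m_1 ≥ ⋯ ≥ m_k ≥ 1`, at level `n`,
labelled by a partition `M` of `n`. -/
def state (c h : ℂ) {n : ℕ} (M : n.Partition) : Verma c h :=
  descendant c h (M.parts.sort (· ≥ ·))

/-- The Gram matrix `B_{M|N}` at level `n`. -/
def gram (c h : ℂ) (n : ℕ) : Matrix n.Partition n.Partition ℂ :=
  Matrix.of fun M N => gramForm c h (state c h M) (state c h N)

theorem L_zero_descendant (c h : ℂ) (l : List ℕ) :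
    L c h 0 (descendant c h l) = (h + l.sum) • descendant c h l := by
  induction l with
  | nil => simp [descendant, L_zero_vac]
  | cons m l ih =>
    have j := congrArg (fun T : Module.End ℂ (Verma c h) => T (descendant c h l))
      (relator_L c h 0 (-(m : ℤ)))
    have hc : central c 0 (-(m : ℤ)) = 0 := by simp [central]
    simp only [relator, LinearMap.sub_apply, LinearMap.add_apply, LinearMap.smul_apply,
      Module.End.mul_apply, Module.End.one_apply, LinearMap.zero_apply, hc, ih, map_smul,
      zero_smul, add_zero, zero_add] at j
    change L c h 0 (L c h (-(m : ℤ)) (descendant c h l)) = _ • L c h (-(m : ℤ)) (descendant c h l)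
    rw [sub_sub, sub_eq_zero] at j
    rw [j, List.sum_cons]
    push_cast
    module

theorem L_zero_state (c h : ℂ) {n : ℕ} (M : n.Partition) :
    L c h 0 (state c h M) = (h + n) • state c h M := by
  rw [state, L_zero_descendant]
  have : (M.parts.sort (· ≥ ·)).sum = n := by
    rw [← Multiset.sum_coe, Multiset.sort_eq, M.parts_sum]
  rw [this]

/-- Between states of the same level the normalised matrix elements of `φ_Δ(z)` do not depend
on `z`. -/
theorem primaryForm_state (Δ c h : ℂ) {n : ℕ} (M N : n.Partition) {k : ℤ} (hk : k ≠ 0) :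
    primaryForm Δ c h (state c h M) (state c h N) k = 0 := by
  have hw := (primaryForm_spec Δ c h).2 0 (state c h M) (state c h N)
  rw [neg_zero, L_zero_state, L_zero_state, map_smul, map_smul, LinearMap.smul_apply,
    left_eq_add] at hw
  have e : ∀ p : ℤ →₀ ℂ, fieldOp Δ 0 p k = k * p k := by
    intro p
    induction p using Finsupp.induction_linear with
    | zero => simp
    | add p q hp hq => simp [hp, hq, mul_add]
    | single j a =>
      rw [fieldOp_single]
      by_cases hjk : j = k
      · subst hjk; simp [mul_comm]
      · simp [hjk]
  have := e (primaryForm Δ c h (state c h M) (state c h N))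
  rw [hw] at this
  simpa [hk] using this.symm

/-- The matrix `⟨h, M| φ_Δ(z) |N, h⟩ / ⟨h| φ_Δ(z) |h⟩` at level `n` (constants in `z`). -/
def primaryMatrix (Δ c h : ℂ) (n : ℕ) : Matrix n.Partition n.Partition ℂ :=
  Matrix.of fun M N => primaryForm Δ c h (state c h M) (state c h N) 0

/-- The level-`n` coefficient `𝒱_n(Δ, h, c)` of the one-point torus block; meaningful when the
Gram matrix at level `n` is invertible. -/
def blockCoeff (Δ h c : ℂ) (n : ℕ) : ℂ :=
  ∑ M : n.Partition, ∑ N : n.Partition, (gram c h n)⁻¹ M N * primaryMatrix Δ c h n M N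

/-- The one-point torus block, stripped of its prefactor:
`q ^ (c / 24 - h) 𝒱(Δ, h, c | q) = ∑ 𝒱_n(Δ, h, c) q ^ n`. -/
def torusBlock (Δ h c : ℂ) : ℂ⟦X⟧ := PowerSeries.mk (blockCoeff Δ h c)

/-- The light block: the (coefficientwise) limit of the block as `c → ∞`, with `Δ`, `h` fixed. -/
def lightBlock (Δ h : ℂ) : ℂ⟦X⟧ :=
  PowerSeries.mk fun n => limUnder (cobounded ℂ) fun c => coeff n (torusBlock Δ h c)

/-- The heavy-light block: the (coefficientwise) limit of the block as `c → ∞`, with `Δ` and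
`ε = h / c` fixed. -/
def heavyLightBlock (Δ ε : ℂ) : ℂ⟦X⟧ :=
  PowerSeries.mk fun n => limUnder (cobounded ℂ) fun c => coeff n (torusBlock Δ (c * ε) c)

/-- The Euler function `φ(q) = ∏_{n ≥ 1} (1 - q ^ n)`, as a formal power series. -/
def eulerFunction : ℂ⟦X⟧ := ∏' n : ℕ, (1 - X ^ (n + 1))

end Virasoro

end

noncomputable section

namespace Virasoro

open Asymptotics

/-! Let `s` be a square root of `c`. A pair `L_m`, `L_{-m}` whose commutator has order `c` behaves
like `s` times an oscillator pair. On a word in such heavy generators, `L_m` acts to leading order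
as `s ^ 2 κ_m` times differentiation with respect to `L_{-m}`, while commuting a generator past the
field costs only `O(1)`. Divide each basis state by `s ^ r`, where `r` is its number of heavy
generators. The Gram matrix then tends to a diagonal matrix, and the field matrix acquires the same
oscillator factors times matrix elements between the remaining light words. The sum defining `𝒱_n`
is invariant under this rescaling, so its limit is a sum over partitions of ratios of light matrix
elements.

For `h = c ε` every `m ≥ 1` is heavy, with `κ_m = m (m ^ 2 - 1) / 12 + 2 m ε`, nonzero by the
condition on `ε`. The light words are empty and each partition contributes 1. For fixed `h` only `m
≥ 2` is heavy and the light words are `L_{-1} ^ k`. As `h → ∞`, field and Gram elements of these are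
both asymptotic to `2 ^ k k! h ^ k`, so each ratio tends to 1. Both limits count partitions, and
Euler's product gives the generating function.

States at different parameters lie in different modules, so growth is recorded by construction
(`Grows`), not by a norm. The bounds are `Grows.L_apply` and `Grows.ward_isBigO`; the leading terms
come from `grows_L_heavy` and `tendsto_ward`; `tendsto_sum_inv_mul` handles the inverse.
`HeavyLight.tendsto_blockCoeff` combines them and is applied once in each regime. -/

theorem L_L_neg (c h : ℂ) (x y : ℤ) (w : Verma c h) :
    L c h x (L c h (-y) w) = L c h (-y) (L c h x w) +
      (((x : ℂ) + y) • L c h (x - y) w + central c x (-y) • w) := by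
  have j := congrArg (fun T : Module.End ℂ (Verma c h) => T w) (relator_L c h x (-y))
  simp only [relator, LinearMap.sub_apply, LinearMap.add_apply, LinearMap.smul_apply,
    Module.End.mul_apply, Module.End.one_apply, LinearMap.zero_apply] at j
  rw [sub_eq_zero, sub_eq_iff_eq_add'] at j
  rw [j]
  push_cast
  rw [sub_neg_eq_add, sub_eq_add_neg]

theorem descendant_cons (c h : ℂ) (m : ℕ) (b : List ℕ) :
    descendant c h (m :: b) = L c h (-(m : ℤ)) (descendant c h b) := rfl

/-! ### Growth of families of states -/

/-- A scaling regime: central charge and dimension depend on a parameter, `s` is the large scale,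
and `L_k` has weight `wt k`, to the effect that it scales at most like `s ^ wt k`. -/
structure Scaling {T : Type*} (l : Filter T) (c h s : T → ℂ) (wt : ℤ → ℕ) : Prop where
  tendsto_scale : Tendsto s l (cobounded ℂ)
  wt_neg : ∀ x, wt (-x) = wt x
  wt_sub : ∀ x y : ℤ, 0 ≤ x → 0 < y → wt (x - y) ≤ wt x + wt y
  dim_isBigO : h =O[l] fun t => s t ^ wt 0
  central_isBigO : ∀ x, (fun t => central (c t) x (-x)) =O[l] fun t => s t ^ (2 * wt x)

/-- The families of states that grow at most like `s ^ k`. -/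
inductive Grows {T : Type*} (l : Filter T) (c h s : T → ℂ) (wt : ℤ → ℕ) :
    ℕ → (∀ t, Verma (c t) (h t)) → Prop
  | vac : Grows l c h s wt 0 fun t => vac (c t) (h t)
  | lower {n : ℤ} {k : ℕ} {v : ∀ t, Verma (c t) (h t)} (hn : 0 < n) :
      Grows l c h s wt k v → Grows l c h s wt (k + wt n) fun t => L (c t) (h t) (-n) (v t)
  | add {k : ℕ} {v w : ∀ t, Verma (c t) (h t)} :
      Grows l c h s wt k v → Grows l c h s wt k w → Grows l c h s wt k fun t => v t + w t
  | smul {j k : ℕ} {g : T → ℂ} {v : ∀ t, Verma (c t) (h t)} :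
      (g =O[l] fun t => s t ^ j) → Grows l c h s wt k v →
        Grows l c h s wt (k + j) fun t => g t • v t

section Growth

variable {T : Type*} {l : Filter T} {c h s : T → ℂ} {wt : ℤ → ℕ}

theorem isBigO_pow_of_le (hs : Tendsto s l (cobounded ℂ)) {i j : ℕ} (hij : i ≤ j) :
    (fun t => s t ^ i) =O[l] fun t => s t ^ j := by
  apply IsBigO.of_bound 1
  filter_upwards [(tendsto_norm_cobounded_atTop.comp hs).eventually_ge_atTop 1] with t ht
  rw [one_mul, norm_pow, norm_pow]
  exact pow_le_pow_right₀ ht hij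

theorem isLittleO_pow_of_lt (hs : Tendsto s l (cobounded ℂ)) {i j : ℕ} (hij : i < j) :
    (fun t => s t ^ i) =o[l] fun t => s t ^ j := by
  have h1 : (fun _ : T => (1 : ℂ)) =o[l] s := by
    rw [isLittleO_const_left]
    exact Or.inr (tendsto_norm_cobounded_atTop.comp hs)
  have h2 := (isBigO_refl (fun t => s t ^ i) l).mul_isLittleO h1
  simp only [mul_one, ← pow_succ] at h2
  exact h2.trans_isBigO (isBigO_pow_of_le hs hij)

theorem isBigO_const_pow (hs : Tendsto s l (cobounded ℂ)) (a : ℂ) (j : ℕ) :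
    (fun _ => a) =O[l] fun t => s t ^ j := by
  have h1 : (fun _ : T => a) =O[l] fun t => s t ^ 0 := by
    simpa using isBigO_const_const (l := l) a (one_ne_zero (α := ℂ))
  exact h1.trans (isBigO_pow_of_le hs (Nat.zero_le _))

namespace Grows

theorem congr {k : ℕ} {v w : ∀ t, Verma (c t) (h t)} (hv : Grows l c h s wt k v)
    (e : ∀ t, w t = v t) : Grows l c h s wt k w := by
  rwa [show w = v from funext e]

theorem mono (hs : Tendsto s l (cobounded ℂ)) {j k : ℕ} (hjk : j ≤ k)
    {v : ∀ t, Verma (c t) (h t)} (hv : Grows l c h s wt j v) : Grows l c h s wt k v := by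
  obtain ⟨i, rfl⟩ := Nat.exists_eq_add_of_le hjk
  exact (hv.smul (isBigO_const_pow hs 1 i)).congr fun t => (one_smul _ _).symm

theorem const_smul (hs : Tendsto s l (cobounded ℂ)) {k : ℕ} (a : ℂ)
    {v : ∀ t, Verma (c t) (h t)} (hv : Grows l c h s wt k v) :
    Grows l c h s wt k fun t => a • v t :=
  hv.smul (isBigO_const_pow hs a 0)

theorem zero (hs : Tendsto s l (cobounded ℂ)) (k : ℕ) :
    Grows l c h s wt k fun _ => 0 :=
  ((vac.const_smul hs 0).mono hs (Nat.zero_le k)).congr fun _ => (zero_smul _ _).symm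

/-- `Grows` builds in only lowering operators; the others are commuted to the right until they meet
the vacuum. Passing `L_{-n}` produces `L_{x-n}`, controlled by subadditivity of the weight, and a
central term that occurs only for `x = n` and then has order `2 * wt x`. -/
theorem L_apply (hS : Scaling l c h s wt) {k : ℕ} {v : ∀ t, Verma (c t) (h t)}
    (hv : Grows l c h s wt k v) :
    ∀ x : ℤ, Grows l c h s wt (k + wt x) fun t => L (c t) (h t) x (v t) := by
  have hs := hS.tendsto_scale
  have neg : ∀ {k : ℕ} {v : ∀ t, Verma (c t) (h t)}, Grows l c h s wt k v → ∀ x : ℤ, x < 0 →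
      Grows l c h s wt (k + wt x) fun t => L (c t) (h t) x (v t) := by
    intro k v hv x hx
    have := hv.lower (n := -x) (by omega)
    rwa [neg_neg, hS.wt_neg] at this
  induction hv with
  | vac =>
    intro x
    rcases lt_trichotomy x 0 with hx | rfl | hx
    · exact neg Grows.vac x hx
    · exact (Grows.vac.smul hS.dim_isBigO).congr fun t => L_zero_vac _ _
    · exact (zero hs _).congr fun t => L_pos_vac _ _ hx
  | @lower n k v hn hv ih =>
    intro x
    by_cases hx : x < 0
    · exact neg (hv.lower hn) x hx
    refine Grows.congr (.add (v := fun t => L (c t) (h t) (-n) (L (c t) (h t) x (v t)))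
      (w := fun t => ((x : ℂ) + n) • L (c t) (h t) (x - n) (v t) + central (c t) x (-n) • v t)
      ?_ (.add ?_ ?_)) fun t => L_L_neg _ _ _ _ _
    · have := (ih x).lower hn
      rwa [add_right_comm] at this
    · refine ((ih (x - n)).const_smul hs _).mono hs ?_
      have := hS.wt_sub x n (by omega) hn
      omega
    · by_cases hxn : x = n
      · subst hxn
        exact (hv.smul (hS.central_isBigO x)).mono hs (by omega)
      · refine (zero hs _).congr fun t => ?_
        rw [central, if_neg (by omega), zero_smul]
  | add _ _ ih₁ ih₂ => exact fun x => ((ih₁ x).add (ih₂ x)).congr fun t => map_add _ _ _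
  | smul hg _ ih =>
    intro x
    have := ((ih x).smul hg).congr fun t => map_smul (L (c t) (h t) x) _ _
    rwa [add_right_comm] at this

/-- The bound on the matrix elements of a covariant field between families of states of bounded
growth. -/
theorem ward_isBigO (hS : Scaling l c h s wt) {D : ℤ → Module.End ℂ (ℤ →₀ ℂ)} {γ : ℤ → ℤ → ℂ}
    (hD : ∀ m p z, D m p z = γ m z * p (z - m)) {x₀ : ℤ →₀ ℂ}
    {ρ : ∀ t, Verma (c t) (h t) →ₗ[ℂ] Verma (c t) (h t) →ₗ[ℂ] (ℤ →₀ ℂ)}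
    (hρ : ∀ t, IsWardForm (c t) (h t) D x₀ (ρ t)) {i k : ℕ} {u v : ∀ t, Verma (c t) (h t)}
    (hu : Grows l c h s wt i u) (hv : Grows l c h s wt k v) (z : ℤ) :
    (fun t => ρ t (u t) (v t) z) =O[l] fun t => s t ^ (i + k) := by
  have hs := hS.tendsto_scale
  induction hu generalizing k v z with
  | vac =>
    rw [zero_add]
    induction hv generalizing z with
    | vac =>
      simp only [(hρ _).1]
      exact isBigO_const_pow hs _ _
    | @lower n k v hn _ ih =>
      -- Moved to the left, `L_{-n}` becomes `L_n` on the vacuum and vanishes. Only the bounded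
      -- operator `D` survives, and it shifts the exponent `z`.
      have e : ∀ t, ρ t (Virasoro.vac (c t) (h t)) (L (c t) (h t) (-n) (v t)) z =
          -γ (-n) z * ρ t (Virasoro.vac (c t) (h t)) (v t) (z + n) := by
        intro t
        have := (hρ t).2 (-n) (Virasoro.vac (c t) (h t)) (v t)
        rw [neg_neg, L_pos_vac _ _ hn, map_zero, LinearMap.zero_apply] at this
        rw [eq_neg_of_add_eq_zero_left this.symm, Finsupp.neg_apply, hD]
        simp
      simp only [e]
      exact ((ih (z + n)).const_mul_left _).trans (isBigO_pow_of_le hs (by omega))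
    | add _ _ ih₁ ih₂ => simpa using (ih₁ z).add (ih₂ z)
    | smul hg _ ih =>
      simp only [map_smul, Finsupp.smul_apply, smul_eq_mul, pow_add]
      exact (hg.mul (ih z)).congr_right fun t => mul_comm _ _
  | @lower n i u hn _ ih =>
    -- Here the generator passes to the right-hand state, so the induction must allow that state and
    -- its growth exponent to vary.
    have e : ∀ t, ρ t (L (c t) (h t) (-n) (u t)) (v t) z =
        ρ t (u t) (L (c t) (h t) n (v t)) z + γ n z * ρ t (u t) (v t) (z - n) := by
      intro t
      rw [(hρ t).2, Finsupp.add_apply, hD]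
    simp only [e]
    refine ((ih (hv.L_apply hS n) z).trans (isBigO_pow_of_le hs (by omega))).add ?_
    exact ((ih hv (z - n)).const_mul_left _).trans (isBigO_pow_of_le hs (by omega))
  | add _ _ ih₁ ih₂ => simpa using (ih₁ hv z).add (ih₂ hv z)
  | smul hg _ ih =>
    simp only [map_smul, LinearMap.smul_apply, Finsupp.smul_apply, smul_eq_mul]
    exact (hg.mul (ih hv z)).congr_right fun t => by ring

end Grows

end Growth

/-! ### Leading behaviour of matrix elements -/

/-- A scaling regime in which the generators `L_{±m}` with `m` heavy scale like `s`, with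
`[L_m, L_{-m}] ≈ s ^ 2 κ_m`, and act boundedly on the light states. -/
structure HeavyLight {T : Type*} (l : Filter T) (c h s : T → ℂ) (wt : ℤ → ℕ) (heavy : ℕ → Prop)
    (light : List ℕ → Prop) (κ : ℕ → ℂ) : Prop extends Scaling l c h s wt where
  wt_heavy : ∀ m, heavy m → wt (m : ℤ) = 1
  -- Subadditivity would only give 2. The sharper bound makes commutators of distinct heavy
  -- generators subleading to `s ^ 2`.
  wt_sub_heavy : ∀ m n, heavy m → heavy n → m ≠ n → wt ((m : ℤ) - n) ≤ 1
  central_heavy : ∀ m : ℕ, heavy m →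
    (fun t => 2 * m * h t + central (c t) m (-m) - s t ^ 2 * κ m) =O[l] fun t => s t ^ 1
  grows_light : ∀ b, light b → Grows l c h s wt 0 fun t => descendant (c t) (h t) b
  grows_heavy_light : ∀ m b, heavy m → light b →
    Grows l c h s wt 0 fun t => L (c t) (h t) m (descendant (c t) (h t) b)

/-- The leading coefficient of the matrix element between two words of heavy generators. -/
def leading (κ : ℕ → ℂ) : List ℕ → List ℕ → ℂ
  | [], [] => 1
  | [], _ :: _ => 0
  | m :: a, b => κ m * b.count m * leading κ a (b.erase m)

/-- Every letter must be contracted with an equal letter of the other word. This is what makes the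
limiting Gram matrix diagonal. -/
theorem leading_eq_zero {κ : ℕ → ℂ} {a b : List ℕ} (hab : ¬ a.Perm b) : leading κ a b = 0 := by
  induction a generalizing b with
  | nil =>
    cases b with
    | nil => exact absurd (List.Perm.refl _) hab
    | cons n b => rfl
  | cons m a ih =>
    rw [leading]
    by_cases hm : m ∈ b
    · rw [ih, mul_zero]
      intro hp
      exact hab (List.cons_perm_iff_perm_erase.2 ⟨hm, hp⟩)
    · rw [List.count_eq_zero_of_not_mem hm]
      simp

/-- The value is the product of `κ m` over the letters times the factorials of their multiplicities.
-/
theorem leading_self_ne_zero {κ : ℕ → ℂ} {a : List ℕ} (ha : ∀ m ∈ a, κ m ≠ 0) :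
    leading κ a a ≠ 0 := by
  induction a with
  | nil => exact one_ne_zero
  | cons m a ih =>
    rw [leading, List.erase_cons_head, List.count_cons_self]
    exact mul_ne_zero (mul_ne_zero (ha m (by simp)) (Nat.cast_ne_zero.2 (Nat.succ_ne_zero _)))
      (ih fun k hk => ha k (by simp [hk]))

namespace HeavyLight

variable {T : Type*} {l : Filter T} {c h s : T → ℂ} {wt : ℤ → ℕ} {heavy : ℕ → Prop}
  {light : List ℕ → Prop} {κ : ℕ → ℂ}

theorem grows_append (hS : HeavyLight l c h s wt heavy light κ) {b lam : List ℕ}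
    (hb : ∀ n ∈ b, heavy n) (hlam : light lam) :
    Grows l c h s wt b.length fun t => descendant (c t) (h t) (b ++ lam) := by
  induction b with
  | nil => exact hS.grows_light _ hlam
  | cons n b ih =>
    have := (ih fun k hk => hb k (by simp [hk])).L_apply hS.toScaling (-(n : ℤ))
    rwa [hS.wt_neg, hS.wt_heavy n (hb n (by simp))] at this

/-- In decreasing order a repeated `m` must head `b`, so putting `L_{-m}` back in front restores the
word without reordering generators. -/
theorem erase_cons_of_sorted {m : ℕ} {b : List ℕ} (hb : (m :: b).Pairwise (· ≥ ·)) (hm : m ∈ b) :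
    m :: b.erase m = b := by
  cases b with
  | nil => simp at hm
  | cons n b =>
    have h1 : n ≤ m := (List.pairwise_cons.1 hb).1 n (by simp)
    have h2 : m ≤ n := by
      rcases List.mem_cons.1 hm with e | hm
      · exact e.le
      · exact (List.pairwise_cons.1 (List.pairwise_cons.1 hb).2).1 m hm
    obtain rfl : m = n := le_antisymm h2 h1
    rw [List.erase_cons_head]

/-- This is the oscillator approximation: each copy of `L_{-m}` met by `L_m` yields `s ^ 2 κ_m`. The
subtracted term has order `b.length + 1`, one more than the remainder. -/
theorem grows_L_heavy (hS : HeavyLight l c h s wt heavy light κ) {m : ℕ} (hm : heavy m)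
    {b lam : List ℕ} (hb : ∀ n ∈ b, heavy n) (hsort : b.Pairwise (· ≥ ·)) (hlam : light lam) :
    Grows l c h s wt b.length fun t => L (c t) (h t) m (descendant (c t) (h t) (b ++ lam)) -
      (s t ^ 2 * κ m * b.count m) • descendant (c t) (h t) (b.erase m ++ lam) := by
  have hs := hS.tendsto_scale
  induction b with
  | nil => exact (hS.grows_heavy_light m lam hm hlam).congr fun t => by simp
  | cons n b ih =>
    have hn : heavy n := hb n (by simp)
    have hb' : ∀ k ∈ b, heavy k := fun k hk => hb k (by simp [hk])
    have hw := hS.grows_append hb' hlam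
    have ih' := (ih hb' (List.pairwise_cons.1 hsort).2).L_apply hS.toScaling (-(n : ℤ))
    rw [hS.wt_neg, hS.wt_heavy n hn] at ih'
    by_cases hmn : m = n
    · subst hmn
      have hg := hw.smul (hS.central_heavy m hm)
      -- `L_0` takes the value `h` plus the level; the level part is constant in `t` and hence
      -- negligible.
      have hg' := (hw.const_smul hs (2 * m * ((b ++ lam).sum : ℂ))).mono hs (Nat.le_succ _)
      refine ((ih'.add hg).add hg').congr fun t => ?_
      have key : L (c t) (h t) (-(m : ℤ)) ((s t ^ 2 * κ m * b.count m) •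
            descendant (c t) (h t) (b.erase m ++ lam)) =
          (s t ^ 2 * κ m * b.count m) • descendant (c t) (h t) (b ++ lam) := by
        by_cases hmb : m ∈ b
        · rw [map_smul, ← descendant_cons, ← List.cons_append, erase_cons_of_sorted hsort hmb]
        · rw [List.count_eq_zero_of_not_mem hmb]
          simp
      rw [List.cons_append, descendant_cons, L_L_neg, sub_self, L_zero_descendant, map_sub, key,
        List.count_cons_self, List.erase_cons_head]
      push_cast
      module
    · have hg := ((hw.L_apply hS.toScaling ((m : ℤ) - n)).const_smul hs ((m : ℂ) + n)).mono hs
        (Nat.add_le_add_left (hS.wt_sub_heavy m n hm hn hmn) _)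
      refine (ih'.add hg).congr fun t => ?_
      rw [List.cons_append, descendant_cons, L_L_neg, central, if_neg (by omega),
        List.count_cons_of_ne (Ne.symm hmn), List.erase_cons_tail (by simpa using Ne.symm hmn),
        List.cons_append, descendant_cons, map_sub, map_smul]
      push_cast
      module

theorem sub_tendsto_zero (hs : Tendsto s l (cobounded ℂ)) {f : T → ℂ} {i j : ℕ} (hij : i < j)
    (hf : f =O[l] fun t => s t ^ i) : Tendsto (fun t => f t / s t ^ j) l (𝓝 0) :=
  (hf.trans_isLittleO (isLittleO_pow_of_lt hs hij)).tendsto_div_nhds_zero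

/-- The leading behaviour of the matrix elements of a covariant field. -/
theorem tendsto_ward (hS : HeavyLight l c h s wt heavy light κ)
    {D : ℤ → Module.End ℂ (ℤ →₀ ℂ)} {γ : ℤ → ℤ → ℂ}
    (hD : ∀ m p z, D m p z = γ m z * p (z - m)) {x₀ : ℤ →₀ ℂ}
    {ρ : ∀ t, Verma (c t) (h t) →ₗ[ℂ] Verma (c t) (h t) →ₗ[ℂ] (ℤ →₀ ℂ)}
    (hρ : ∀ t, IsWardForm (c t) (h t) D x₀ (ρ t)) {lam mu : List ℕ} (hlam : light lam)
    (hmu : light mu) (z : ℤ) {τ : ℂ}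
    (hτ : Tendsto (fun t => ρ t (descendant (c t) (h t) lam) (descendant (c t) (h t) mu) z) l (𝓝 τ))
    {a b : List ℕ} (ha : ∀ m ∈ a, heavy m) (hb : ∀ m ∈ b, heavy m)
    (hsort : b.Pairwise (· ≥ ·)) :
    Tendsto (fun t => ρ t (descendant (c t) (h t) (a ++ lam)) (descendant (c t) (h t) (b ++ mu)) z /
      s t ^ (a.length + b.length)) l (𝓝 (leading κ a b * τ)) := by
  have hs := hS.tendsto_scale
  have hs0 : ∀ᶠ t in l, s t ≠ 0 := hs.eventually_ne_cobounded 0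
  induction a generalizing b with
  | nil =>
    cases b with
    | nil => simpa [leading] using hτ
    | cons n b =>
      have hn := hb n (by simp)
      have hb' : ∀ k ∈ b, heavy k := fun k hk => hb k (by simp [hk])
      have hw := hS.grows_append hb' hmu
      -- Moved onto the light word, `L_{-n}` yields no power of `s`, whereas the normalisation
      -- reserves one for it.
      have h1 := Grows.ward_isBigO hS.toScaling hD hρ (hS.grows_heavy_light n lam hn hlam) hw z
      have h2 := (Grows.ward_isBigO hS.toScaling hD hρ (hS.grows_light lam hlam) hw
        (z + n)).const_mul_left (γ (-n) z)
      rw [leading, zero_mul]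
      refine sub_tendsto_zero hs (i := 0 + b.length) (by simp) ((h1.sub h2).congr_left fun t => ?_)
      have := (hρ t).2 (-n) (descendant (c t) (h t) lam) (descendant (c t) (h t) (b ++ mu))
      rw [neg_neg] at this
      rw [this, Finsupp.add_apply, hD, sub_neg_eq_add, add_sub_cancel_right]
      rfl
  | cons m a ih =>
    have hm := ha m (by simp)
    have ha' : ∀ k ∈ a, heavy k := fun k hk => ha k (by simp [hk])
    have hsort' : (b.erase m).Pairwise (· ≥ ·) := hsort.sublist List.erase_sublist
    have hb' : ∀ k ∈ b.erase m, heavy k := fun k hk => hb k (List.mem_of_mem_erase hk)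
    have hu := hS.grows_append ha' hlam
    -- The remainder of `L_m` and the commutator with the field both fall one power of `s` short.
    -- Hence `D` affects the limit only through `τ`.
    have h1 := sub_tendsto_zero hs (j := (m :: a).length + b.length) (by simp)
      (Grows.ward_isBigO hS.toScaling hD hρ hu (hS.grows_L_heavy hm hb hsort hmu) z)
    have h2 := sub_tendsto_zero hs (j := (m :: a).length + b.length) (by simp)
      ((Grows.ward_isBigO hS.toScaling hD hρ hu (hS.grows_append hb hmu) (z - m)).const_mul_left
        (γ m z))
    have h3 := (ih ha' hb' hsort').const_mul (κ m * b.count m)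
    have h4 := (h3.add h1).add h2
    rw [add_zero, add_zero, ← mul_assoc] at h4
    rw [leading]
    refine h4.congr' ?_
    filter_upwards [hs0] with t ht
    have e : ρ t (descendant (c t) (h t) (m :: a ++ lam)) (descendant (c t) (h t) (b ++ mu)) z =
        ρ t (descendant (c t) (h t) (a ++ lam))
          (L (c t) (h t) m (descendant (c t) (h t) (b ++ mu))) z +
        γ m z * ρ t (descendant (c t) (h t) (a ++ lam)) (descendant (c t) (h t) (b ++ mu))
          (z - m) := by
      rw [List.cons_append, descendant_cons, (hρ t).2, Finsupp.add_apply, hD]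
    rw [e, map_sub, map_smul, Finsupp.sub_apply, Finsupp.smul_apply, smul_eq_mul, add_div,
      sub_div]
    -- A contraction removes one letter from each word, which accounts for the factor `s ^ 2`;
    -- without one the count is zero.
    by_cases hmb : m ∈ b
    · have hl : (m :: a).length + b.length = (a.length + (b.erase m).length) + 2 := by
        have := List.length_erase_add_one hmb
        simp only [List.length_cons]
        omega
      rw [hl, pow_add]
      field_simp
      ring
    · rw [List.count_eq_zero_of_not_mem hmb]
      simp

end HeavyLight
/-! ### Limits of traces against inverse matrices -/

theorem diagonal_inv_of_ne_zero {ι : Type*} [Fintype ι] [DecidableEq ι] {b : ι → ℂ}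
    (hb : ∀ i, b i ≠ 0) : (Matrix.diagonal b)⁻¹ = Matrix.diagonal fun i => (b i)⁻¹ := by
  apply Matrix.inv_eq_right_inv
  rw [Matrix.diagonal_mul_diagonal, ← Matrix.diagonal_one]
  congr 1
  funext i
  exact mul_inv_cancel₀ (hb i)

/-- If, after a rescaling of the basis, a family of matrices converges to an invertible diagonal
matrix, then the pairing of its inverse with another convergent family converges. -/
theorem tendsto_sum_inv_mul {ι T : Type*} [Fintype ι] [DecidableEq ι] {l : Filter T}
    {B P : T → Matrix ι ι ℂ} {d : T → ι → ℂ} (hd : ∀ᶠ t in l, ∀ i, d t i ≠ 0) {b : ι → ℂ}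
    (hb : ∀ i, b i ≠ 0) {Q : Matrix ι ι ℂ}
    (hB : ∀ i j, Tendsto (fun t => B t i j / (d t i * d t j)) l (𝓝 (Matrix.diagonal b i j)))
    (hP : ∀ i j, Tendsto (fun t => P t i j / (d t i * d t j)) l (𝓝 (Q i j))) :
    (∀ᶠ t in l, IsUnit (B t).det) ∧
      Tendsto (fun t => ∑ i, ∑ j, (B t)⁻¹ i j * P t i j) l (𝓝 (∑ i, Q i i / b i)) := by
  let X : T → Matrix ι ι ℂ := fun t => Matrix.of fun i j => B t i j / (d t i * d t j)
  have hX : Tendsto X l (𝓝 (Matrix.diagonal b)) :=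
    tendsto_pi_nhds.2 fun i => tendsto_pi_nhds.2 fun j => hB i j
  have hBX : ∀ᶠ t in l, B t = Matrix.diagonal (d t) * X t * Matrix.diagonal (d t) := by
    filter_upwards [hd] with t ht
    ext i j
    rw [Matrix.mul_diagonal, Matrix.diagonal_mul]
    have h1 := ht i
    have h2 := ht j
    simp only [X, Matrix.of_apply]
    field_simp
  have hdetb : (Matrix.diagonal b).det ≠ 0 := by
    rw [Matrix.det_diagonal]
    exact Finset.prod_ne_zero_iff.2 fun i _ => hb i
  have hdet : Tendsto (fun t => (X t).det) l (𝓝 (Matrix.diagonal b).det) :=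
    ((continuous_id.matrix_det).tendsto _).comp hX
  have hinv : Tendsto (fun t => (X t)⁻¹) l (𝓝 (Matrix.diagonal b)⁻¹) := by
    simp only [Matrix.inv_def, Ring.inverse_eq_inv]
    exact (hdet.inv₀ hdetb).smul (((continuous_id.matrix_adjugate).tendsto _).comp hX)
  refine ⟨?_, ?_⟩
  · filter_upwards [hBX, hdet.eventually_ne hdetb, hd] with t ht hXt hdt
    rw [ht, Matrix.det_mul, Matrix.det_mul, Matrix.det_diagonal]
    have h1 : ∏ i, d t i ≠ 0 := Finset.prod_ne_zero_iff.2 fun i _ => hdt i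
    exact isUnit_iff_ne_zero.2 (mul_ne_zero (mul_ne_zero h1 hXt) h1)
  · have h1 : Tendsto (fun t => ∑ i, ∑ j, (X t)⁻¹ i j * (P t i j / (d t i * d t j))) l
        (𝓝 (∑ i, ∑ j, (Matrix.diagonal b)⁻¹ i j * Q i j)) := by
      refine tendsto_finsetSum _ fun i _ => tendsto_finsetSum _ fun j _ => ?_
      exact ((tendsto_pi_nhds.1 (tendsto_pi_nhds.1 hinv i)) j).mul (hP i j)
    have h2 : ∑ i, ∑ j, (Matrix.diagonal b)⁻¹ i j * Q i j = ∑ i, Q i i / b i := by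
      refine Finset.sum_congr rfl fun i _ => ?_
      rw [diagonal_inv_of_ne_zero hb, Finset.sum_eq_single i]
      · rw [Matrix.diagonal_apply_eq, div_eq_mul_inv, mul_comm]
      · intro j _ hj
        rw [Matrix.diagonal_apply_ne _ hj.symm, zero_mul]
      · simp
    rw [h2] at h1
    -- The sum is invariant under the rescaling: `B⁻¹` carries the inverse factors of `d i * d j`,
    -- which cancel those of `P` entry by entry.
    refine h1.congr' ?_
    filter_upwards [hBX, hd] with t ht hdt
    refine Finset.sum_congr rfl fun i _ => Finset.sum_congr rfl fun j _ => ?_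
    rw [ht, Matrix.mul_inv_rev, Matrix.mul_inv_rev, diagonal_inv_of_ne_zero hdt,
      Matrix.diagonal_mul, Matrix.mul_diagonal]
    have h1 := hdt i
    have h2 := hdt j
    field_simp

/-! ### The Gram form and the primary form as covariant forms -/

/-- The Gram form, with values in constant Laurent polynomials. -/
def gramLaurent (c h : ℂ) : Verma c h →ₗ[ℂ] Verma c h →ₗ[ℂ] (ℤ →₀ ℂ) :=
  (gramForm c h).compr₂ (Finsupp.lsingle 0)

theorem gramLaurent_apply (c h : ℂ) (u w : Verma c h) :
    gramLaurent c h u w = Finsupp.single 0 (gramForm c h u w) := rfl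

/-- The Gram form is treated as the matrix elements of the identity field (`D = 0`), so one
asymptotic lemma serves both matrices. -/
theorem gramLaurent_spec (c h : ℂ) :
    IsWardForm c h (fun _ => (0 : Module.End ℂ (ℤ →₀ ℂ))) (Finsupp.single 0 1)
      (gramLaurent c h) := by
  refine ⟨by rw [gramLaurent_apply, (gramForm_spec c h).1], fun m u w => ?_⟩
  rw [gramLaurent_apply, gramLaurent_apply, (gramForm_spec c h).2]
  simp

/-- This is the shift-and-scale form assumed by the growth estimates, with a factor independent of
`c` and `h`. -/
theorem fieldOp_apply (Δ : ℂ) (m : ℤ) (p : ℤ →₀ ℂ) (z : ℤ) :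
    fieldOp Δ m p z = (((z - m : ℤ) : ℂ) + m * Δ) * p (z - m) := by
  induction p using Finsupp.induction_linear with
  | zero => simp
  | add p q hp hq => simp [hp, hq, mul_add]
  | single j a =>
    rw [fieldOp_single]
    by_cases hjz : j = z - m
    · subst hjz
      simp [mul_comm]
    · have : j + m ≠ z := by omega
      simp [hjz, this]

/-- The limit of the level-`n` coefficient of the torus block in a heavy-light regime. -/
theorem HeavyLight.tendsto_blockCoeff {T : Type*} {l : Filter T} {c h s : T → ℂ} {wt : ℤ → ℕ}
    {heavy : ℕ → Prop} {light : List ℕ → Prop} {κ : ℕ → ℂ}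
    (hS : HeavyLight l c h s wt heavy light κ) (hκ : ∀ m, heavy m → κ m ≠ 0) (Δ : ℂ) {n : ℕ}
    (hv lt : n.Partition → List ℕ) (hsplit : ∀ M, M.parts.sort (· ≥ ·) = hv M ++ lt M)
    (hinj : ∀ M N, (hv M).Perm (hv N) → M = N) (hheavy : ∀ M, ∀ m ∈ hv M, heavy m)
    (hlight : ∀ M, light (lt M)) (τG τP : n.Partition → n.Partition → ℂ)
    (hG : ∀ M N, Tendsto (fun t => gramLaurent (c t) (h t) (descendant (c t) (h t) (lt M))
      (descendant (c t) (h t) (lt N)) 0) l (𝓝 (τG M N)))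
    (hP : ∀ M N, Tendsto (fun t => primaryForm Δ (c t) (h t) (descendant (c t) (h t) (lt M))
      (descendant (c t) (h t) (lt N)) 0) l (𝓝 (τP M N)))
    (hne : ∀ M, τG M M ≠ 0) :
    (∀ᶠ t in l, IsUnit (gram (c t) (h t) n).det) ∧
      Tendsto (fun t => blockCoeff Δ (h t) (c t) n) l (𝓝 (∑ M, τP M M / τG M M)) := by
  have hlead : ∀ M, leading κ (hv M) (hv M) ≠ 0 := fun M =>
    leading_self_ne_zero fun m hm => hκ m (hheavy M m hm)
  have hsort : ∀ M, (hv M).Pairwise (· ≥ ·) := fun M => by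
    have := M.parts.pairwise_sort (· ≥ ·)
    rw [hsplit] at this
    exact this.sublist (List.sublist_append_left _ _)
  have hs0 : ∀ᶠ t in l, s t ≠ 0 := hS.tendsto_scale.eventually_ne_cobounded 0
  have e : ∑ M, τP M M / τG M M = ∑ M, (Matrix.of fun M N => leading κ (hv M) (hv N) * τP M N) M M /
      (leading κ (hv M) (hv M) * τG M M) :=
    Finset.sum_congr rfl fun M _ => (mul_div_mul_left _ _ (hlead M)).symm
  rw [e]
  refine tendsto_sum_inv_mul (d := fun t M => s t ^ (hv M).length)
    (hs0.mono fun t ht M => pow_ne_zero _ ht) (fun M => mul_ne_zero (hlead M) (hne M)) ?_ ?_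
  · intro M N
    have := hS.tendsto_ward (γ := fun _ _ => 0) (by simp)
      (fun t => gramLaurent_spec (c t) (h t)) (hlight M) (hlight N) 0 (hG M N)
      (hheavy M) (hheavy N) (hsort N)
    -- Distinct partitions have inequivalent heavy words, so the off-diagonal limits vanish whatever
    -- the light elements are.
    have e2 : leading κ (hv M) (hv N) * τG M N =
        Matrix.diagonal (fun M => leading κ (hv M) (hv M) * τG M M) M N := by
      by_cases hMN : M = N
      · subst hMN
        rw [Matrix.diagonal_apply_eq]
      · rw [Matrix.diagonal_apply_ne _ hMN, leading_eq_zero fun hp => hMN (hinj M N hp), zero_mul]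
    rw [← e2]
    refine this.congr fun t => ?_
    rw [← hsplit, ← hsplit, pow_add, gramLaurent_apply, Finsupp.single_eq_same]
    rfl
  · intro M N
    have := hS.tendsto_ward (fieldOp_apply Δ)
      (fun t => primaryForm_spec Δ (c t) (h t)) (hlight M) (hlight N) 0 (hP M N)
      (hheavy M) (hheavy N) (hsort N)
    refine this.congr fun t => ?_
    rw [← hsplit, ← hsplit, pow_add]
    rfl

/-! ### The states `L_{-1} ^ k |h⟩` -/

/-- The matrix elements `⟨h| φ L_{-1} ^ k |h⟩` of a covariant field. -/
def lightBase (D : ℤ → Module.End ℂ (ℤ →₀ ℂ)) : ℕ → (ℤ →₀ ℂ)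
  | 0 => Finsupp.single 0 1
  | k + 1 => -D (-1) (lightBase D k)

/-- The matrix elements `⟨h| L_1 ^ j φ L_{-1} ^ k |h⟩` of a covariant field. -/
def lightVal (D : ℤ → Module.End ℂ (ℤ →₀ ℂ)) (h : ℂ) : ℕ → ℕ → (ℤ →₀ ℂ)
  | 0, k => lightBase D k
  | j + 1, k => (k * (2 * h + k - 1)) • lightVal D h j (k - 1) + D 1 (lightVal D h j k)

/-- An `sl_2` computation: `[L_1, L_{-1}] = 2 L_0` has no central term, and `2 (h + i)` is summed
over `i < k`. At `k = 0` the truncated `k - 1` is harmless because the coefficient is zero. -/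
theorem L_one_descendant (c h : ℂ) (k : ℕ) :
    L c h 1 (descendant c h (List.replicate k 1)) =
      ((k : ℂ) * (2 * h + k - 1)) • descendant c h (List.replicate (k - 1) 1) := by
  induction k with
  | zero => simp [descendant, L_pos_vac]
  | succ k ih =>
    rw [List.replicate_succ, descendant_cons, Nat.cast_one, L_L_neg, ih, map_smul, sub_self,
      L_zero_descendant, Nat.add_sub_cancel]
    have e : ((k : ℂ) * (2 * h + k - 1)) • L c h (-1) (descendant c h (List.replicate (k - 1) 1)) =
        ((k : ℂ) * (2 * h + k - 1)) • descendant c h (List.replicate k 1) := by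
      cases k with
      | zero => simp
      | succ k => rfl
    rw [e]
    simp only [central, List.sum_replicate, smul_eq_mul, mul_one]
    push_cast
    simp only [one_pow, sub_self, mul_zero]
    module

/-- Only modes of `sl_2` intervene, so these elements are independent of `c`: in the light regime
they are constant along the limit. -/
theorem ward_light (c h : ℂ) {D : ℤ → Module.End ℂ (ℤ →₀ ℂ)}
    {ρ : Verma c h →ₗ[ℂ] Verma c h →ₗ[ℂ] (ℤ →₀ ℂ)}
    (hρ : IsWardForm c h D (Finsupp.single 0 1) ρ) (j k : ℕ) :
    ρ (descendant c h (List.replicate j 1)) (descendant c h (List.replicate k 1)) =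
      lightVal D h j k := by
  induction j generalizing k with
  | zero =>
    change ρ (vac c h) _ = lightBase D k
    induction k with
    | zero => exact hρ.1
    | succ k ih =>
      have := hρ.2 (-1) (vac c h) (descendant c h (List.replicate k 1))
      rw [neg_neg, L_pos_vac c h one_pos, map_zero, LinearMap.zero_apply, ih] at this
      exact eq_neg_of_add_eq_zero_left this.symm
  | succ j ih =>
    have := hρ.2 1 (descendant c h (List.replicate j 1)) (descendant c h (List.replicate k 1))
    rw [L_one_descendant, map_smul, ih, ih] at this
    exact this

/-- The large-`h` behaviour of the matrix elements of a covariant field between light states. -/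
theorem tendsto_lightVal {D : ℤ → Module.End ℂ (ℤ →₀ ℂ)} {γ : ℤ → ℤ → ℂ}
    (hD : ∀ m p z, D m p z = γ m z * p (z - m)) (j k : ℕ) (z : ℤ) :
    Tendsto (fun h => lightVal D h j k z / h ^ j) (cobounded ℂ)
      (𝓝 (2 ^ j * k.descFactorial j * lightBase D (k - j) z)) := by
  induction j generalizing k z with
  | zero => simp [lightVal]
  | succ j ih =>
    have hinv : Tendsto (fun h : ℂ => h⁻¹) (cobounded ℂ) (𝓝 0) := tendsto_inv₀_cobounded
    -- This is `k (2 h + k - 1) / h`. The term with `D 1` has one power of `h` fewer and drops out.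
    have h1 : Tendsto (fun h : ℂ => 2 * (k : ℂ) + k * (k - 1) * h⁻¹) (cobounded ℂ)
        (𝓝 (2 * k)) := by
      simpa using (hinv.const_mul ((k : ℂ) * (k - 1))).const_add (2 * (k : ℂ))
    have h2 := (h1.mul (ih (k - 1) z)).add (((ih k (z - 1)).const_mul (γ 1 z)).mul hinv)
    have e : 2 * (k : ℂ) * (2 ^ j * (k - 1).descFactorial j * lightBase D (k - 1 - j) z) +
        γ 1 z * (2 ^ j * k.descFactorial j * lightBase D (k - j) (z - 1)) * 0 =
        2 ^ (j + 1) * k.descFactorial (j + 1) * lightBase D (k - (j + 1)) z := by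
      cases k with
      | zero => simp
      | succ k =>
        rw [Nat.succ_descFactorial_succ, Nat.add_sub_cancel, Nat.add_sub_add_right]
        push_cast
        ring
    rw [e] at h2
    refine h2.congr' ?_
    filter_upwards [eventually_ne_cobounded (0 : ℂ)] with h hh
    rw [lightVal, Finsupp.add_apply, Finsupp.smul_apply, smul_eq_mul, hD]
    field_simp
    ring

/-- On the diagonal `D` disappears from the leading term, so the Gram form and the field have the
same asymptotics. -/
theorem tendsto_lightVal_self {D : ℤ → Module.End ℂ (ℤ →₀ ℂ)} {γ : ℤ → ℤ → ℂ}
    (hD : ∀ m p z, D m p z = γ m z * p (z - m)) (k : ℕ) :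
    Tendsto (fun h => lightVal D h k k 0 / h ^ k) (cobounded ℂ) (𝓝 (2 ^ k * k.factorial)) := by
  have := tendsto_lightVal hD k k 0
  rwa [Nat.descFactorial_self, Nat.sub_self, lightBase, Finsupp.single_eq_same, mul_one] at this

/-- The norm of `L_{-1} ^ k |h⟩` is `k!` times the product of `2 h + i` over `i < k`. -/
theorem lightVal_gram_ne_zero {h : ℂ} {k : ℕ} (hk : ∀ i < k, 2 * h ≠ -(i : ℂ)) :
    lightVal (fun _ => (0 : Module.End ℂ (ℤ →₀ ℂ))) h k k 0 ≠ 0 := by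
  induction k with
  | zero => simp [lightVal, lightBase]
  | succ k ih =>
    have h1 : (2 * h + (k : ℂ)) ≠ 0 := fun e => hk k k.lt_succ_self (eq_neg_of_add_eq_zero_left e)
    rw [lightVal, LinearMap.zero_apply, add_zero, Finsupp.smul_apply, smul_eq_mul]
    refine mul_ne_zero (mul_ne_zero (Nat.cast_ne_zero.2 k.succ_ne_zero) ?_)
      (ih fun i hi => hk i (by omega))
    push_cast
    rwa [show 2 * h + (k + 1 : ℂ) - 1 = 2 * h + k by ring]

/-! ### The light and heavy-light regimes -/

/-- A square root of the central charge. -/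
def scale (c : ℂ) : ℂ := c ^ ((2 : ℕ)⁻¹ : ℂ)

theorem scale_sq (c : ℂ) : scale c ^ 2 = c := Complex.cpow_nat_inv_pow c two_ne_zero

theorem tendsto_scale : Tendsto scale (cobounded ℂ) (cobounded ℂ) := by
  rw [← tendsto_norm_atTop_iff_cobounded]
  have e : ∀ c, ‖scale c‖ = √‖c‖ := fun c => by
    rw [eq_comm, Real.sqrt_eq_iff_mul_self_eq (norm_nonneg _) (norm_nonneg _), ← sq, ← norm_pow,
      scale_sq]
  simp only [e]
  exact Real.tendsto_sqrt_atTop.comp tendsto_norm_cobounded_atTop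

theorem central_isBigO_scale (x : ℤ) :
    (fun c => central c x (-x)) =O[cobounded ℂ] fun c => scale c ^ 2 := by
  have : ∀ c, central c x (-x) = x * ((x : ℂ) ^ 2 - 1) / 12 * scale c ^ 2 := fun c => by
    rw [central, if_pos (by omega), scale_sq]
    ring
  simp only [this]
  exact (isBigO_refl _ _).const_mul_left _

/-- The weights in the light regime. -/
def lightWt (k : ℤ) : ℕ := if k.natAbs ≤ 1 then 0 else 1

/-- The weights in the heavy-light regime. -/
def heavyWt (k : ℤ) : ℕ := if k = 0 then 2 else 1

/-- The light regime: `c → ∞` with `h` fixed. -/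
theorem heavyLight_light (h : ℂ) :
    HeavyLight (cobounded ℂ) (fun c => c) (fun _ => h) scale lightWt (fun m => 2 ≤ m)
      (fun b => ∃ j, b = List.replicate j 1) (fun m => m * ((m : ℂ) ^ 2 - 1) / 12) := by
  have hS : Scaling (cobounded ℂ) (fun c => c) (fun _ => h) scale lightWt :=
    { tendsto_scale := tendsto_scale
      wt_neg := fun x => by simp [lightWt]
      wt_sub := fun x y hx hy => by
        unfold lightWt
        split_ifs <;> omega
      dim_isBigO := isBigO_const_pow tendsto_scale h _
      central_isBigO := fun x => by
        by_cases hx : x.natAbs ≤ 1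
        · have e : ∀ c, central c x (-x) = 0 := fun c => by
            have : x = 0 ∨ x = 1 ∨ x = -1 := by omega
            rcases this with rfl | rfl | rfl <;> simp [central]
          simp only [e]
          exact isBigO_zero _ _
        · rw [lightWt, if_neg hx]
          exact central_isBigO_scale x }
  -- For `x ≥ 2` the weight bound gives only `O(s)`. Commuting past `L_{-1}` lowers `x` by one with
  -- no central term, so every path ends in `sl_2` or kills the vacuum, and the result is `O(1)`.
  have hL : ∀ j : ℕ, ∀ x : ℤ, -1 ≤ x → Grows (cobounded ℂ) (fun c => c) (fun _ => h) scale lightWt 0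
      fun c => L c h x (descendant c h (List.replicate j 1)) := by
    have low : ∀ x : ℤ, x.natAbs ≤ 1 → ∀ {v : ∀ c, Verma c h},
        Grows (cobounded ℂ) (fun c => c) (fun _ => h) scale lightWt 0 v →
        Grows (cobounded ℂ) (fun c => c) (fun _ => h) scale lightWt 0 fun c => L c h x (v c) := by
      intro x hx v hv
      have := hv.L_apply hS x
      rwa [lightWt, if_pos hx] at this
    intro j
    induction j with
    | zero =>
      intro x hx
      by_cases hx1 : x.natAbs ≤ 1
      · exact low x hx1 Grows.vac
      · exact (Grows.zero tendsto_scale 0).congr fun c => L_pos_vac _ _ (by omega)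
    | succ j ih =>
      intro x hx
      by_cases hx1 : x = -1
      · subst hx1
        exact low _ (by simp) (ih (-1) le_rfl)
      · refine ((low (-1) (by simp) (ih x hx)).add
          ((ih (x - 1) (by omega)).const_smul tendsto_scale ((x : ℂ) + 1))).congr fun c => ?_
        have hc : central c x (-1) = 0 := by
          unfold central
          split_ifs with e
          · obtain rfl : x = 1 := by omega
            simp
          · rfl
        rw [List.replicate_succ, descendant_cons, Nat.cast_one, L_L_neg, hc]
        simp
  have hlight : ∀ j : ℕ, Grows (cobounded ℂ) (fun c => c) (fun _ => h) scale lightWt 0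
      fun c => descendant c h (List.replicate j 1) := by
    intro j
    cases j with
    | zero => exact Grows.vac
    | succ j => exact hL j (-1) le_rfl
  exact
    { hS with
      wt_heavy := fun m hm => by rw [lightWt, if_neg (by omega)]
      wt_sub_heavy := fun m n _ _ _ => by unfold lightWt; split_ifs <;> omega
      central_heavy := fun m _ => by
        have e : ∀ c, 2 * m * h + central c m (-m) - scale c ^ 2 * (m * ((m : ℂ) ^ 2 - 1) / 12) =
            2 * m * h := fun c => by
          rw [central, if_pos (by omega), scale_sq]
          push_cast
          ring
        simp only [e]
        exact isBigO_const_pow tendsto_scale _ _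
      grows_light := by
        rintro _ ⟨j, rfl⟩
        exact hlight j
      grows_heavy_light := by
        rintro m _ hm ⟨j, rfl⟩
        exact hL j m (by omega) }

/-- The heavy-light regime: `c → ∞` with `h / c` fixed. -/
theorem heavyLight_heavy (ε : ℂ) :
    HeavyLight (cobounded ℂ) (fun c => c) (fun c => c * ε) scale heavyWt (fun m => 1 ≤ m)
      (fun b => b = []) (fun m => m * ((m : ℂ) ^ 2 - 1) / 12 + 2 * m * ε) where
  tendsto_scale := tendsto_scale
  wt_neg x := by simp [heavyWt]
  wt_sub x y hx hy := by
    unfold heavyWt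
    split_ifs <;> omega
  dim_isBigO := by
    have e : (fun c => c * ε) = fun c => ε * scale c ^ 2 := by
      funext c
      rw [scale_sq, mul_comm]
    rw [e]
    exact (isBigO_refl _ _).const_mul_left _
  central_isBigO x := by
    refine (central_isBigO_scale x).trans (isBigO_pow_of_le tendsto_scale ?_)
    unfold heavyWt
    split_ifs <;> omega
  wt_heavy m hm := by rw [heavyWt, if_neg (by omega)]
  wt_sub_heavy m n _ _ hmn := by rw [heavyWt, if_neg (by omega)]
  -- As `h` is proportional to `c`, the commutator on the vacuum is exactly `s ^ 2 κ_m`.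
  central_heavy m _ := by
    have e : ∀ c, 2 * m * (c * ε) + central c m (-m) -
        scale c ^ 2 * (m * ((m : ℂ) ^ 2 - 1) / 12 + 2 * m * ε) = 0 := fun c => by
      rw [central, if_pos (by omega), scale_sq]
      push_cast
      ring
    simp only [e]
    exact isBigO_zero _ _
  grows_light := by
    rintro _ rfl
    exact Grows.vac
  grows_heavy_light := by
    rintro m _ hm rfl
    exact (Grows.zero tendsto_scale 0).congr fun c => L_pos_vac _ _ (by omega)

/-! ### Partitions -/

theorem eq_filter_append_replicate {b : List ℕ} (hb : ∀ m ∈ b, 0 < m)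
    (hsort : b.Pairwise (· ≥ ·)) :
    b = b.filter (2 ≤ ·) ++ List.replicate (b.count 1) 1 := by
  induction b with
  | nil => rfl
  | cons n b ih =>
    have hn := hb n (by simp)
    have ih' := ih (fun m hm => hb m (by simp [hm])) (List.pairwise_cons.1 hsort).2
    by_cases h2 : 2 ≤ n
    · rw [List.filter_cons_of_pos (by simpa using h2), List.count_cons_of_ne (by omega),
        List.cons_append, ← ih']
    · obtain rfl : n = 1 := by omega
      have hnil : b.filter (2 ≤ ·) = [] := by
        rw [List.filter_eq_nil_iff]
        intro m hm
        have := (List.pairwise_cons.1 hsort).1 m hm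
        simp
        omega
      rw [hnil, List.nil_append] at ih'
      rw [List.filter_cons_of_neg (by simp), hnil, List.count_cons_self, List.replicate_succ,
        List.nil_append, ← ih']

theorem sort_split {n : ℕ} (M : n.Partition) :
    M.parts.sort (· ≥ ·) = (M.parts.sort (· ≥ ·)).filter (2 ≤ ·) ++
      List.replicate ((M.parts.sort (· ≥ ·)).count 1) 1 :=
  eq_filter_append_replicate (fun _ hm => M.parts_pos ((Multiset.mem_sort _).1 hm))
    (M.parts.pairwise_sort _)

theorem sum_sort {n : ℕ} (M : n.Partition) : (M.parts.sort (· ≥ ·)).sum = n := by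
  rw [← Multiset.sum_coe, Multiset.sort_eq, M.parts_sum]

theorem partition_ext_of_perm_sort {n : ℕ} {M N : n.Partition}
    (hMN : (M.parts.sort (· ≥ ·)).Perm (N.parts.sort (· ≥ ·))) : M = N := by
  apply Nat.Partition.ext
  rw [← M.parts.sort_eq (· ≥ ·), ← N.parts.sort_eq (· ≥ ·)]
  exact Multiset.coe_eq_coe.2 hMN

/-- The number of ones is `n` minus the sum of the other parts. Hence heavy words alone separate the
basis states at a given level. -/
theorem partition_ext_of_perm_filter {n : ℕ} {M N : n.Partition}
    (hMN : ((M.parts.sort (· ≥ ·)).filter (2 ≤ ·)).Perm ((N.parts.sort (· ≥ ·)).filter (2 ≤ ·))) :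
    M = N := by
  have h1 := congrArg List.sum (sort_split M)
  have h2 := congrArg List.sum (sort_split N)
  rw [sum_sort, List.sum_append, List.sum_replicate, smul_eq_mul, mul_one] at h1 h2
  have hc : (M.parts.sort (· ≥ ·)).count 1 = (N.parts.sort (· ≥ ·)).count 1 := by
    have := hMN.sum_eq
    omega
  apply partition_ext_of_perm_sort
  rw [sort_split M, sort_split N, hc]
  exact hMN.append_right _

/-- At level `n` only `L_{-1} ^ k` with `k ≤ n` occur, so excluding `2 h = -i` for `i < n` suffices.
-/
theorem count_one_le {n : ℕ} (M : n.Partition) : (M.parts.sort (· ≥ ·)).count 1 ≤ n := by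
  have h1 := congrArg List.sum (sort_split M)
  rw [sum_sort, List.sum_append, List.sum_replicate, smul_eq_mul, mul_one] at h1
  omega

/-- The partition numbers are the coefficients of the inverse Euler function. -/
theorem inv_eulerFunction :
    eulerFunction⁻¹ = PowerSeries.mk fun n => (Fintype.card n.Partition : ℂ) := by
  have h1 := Nat.Partition.hasProd_powerSeriesMk_card_restricted ℂ (fun _ => True)
  have h2 := (WithPiTopology.multipliable_one_sub_X_pow ℂ).hasProd
  have h3 := h1.mul h2
  -- The two products are inverse factor by factor, each factor being a geometric series times `1 -
  -- X ^ (i + 1)`.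
  have h4 : (fun i : ℕ => (if True then ∑' j : ℕ, (X : ℂ⟦X⟧) ^ ((i + 1) * j) else 1) *
      (1 - X ^ (i + 1))) = fun _ => 1 := by
    funext i
    rw [if_pos trivial]
    simp_rw [pow_mul]
    exact WithPiTopology.tsum_pow_mul_one_sub_of_constantCoeff_eq_zero (by simp)
  rw [h4] at h3
  have h5 := h3.unique hasProd_one
  have hcard : ∀ n : ℕ, (Nat.Partition.restricted n fun _ => True).card =
      Fintype.card n.Partition := fun n => by
    simp [Nat.Partition.restricted, Finset.card_univ]
  simp only [hcard] at h5
  have hc : constantCoeff eulerFunction ≠ 0 := by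
    intro h0
    have := congrArg (constantCoeff (R := ℂ)) h5
    rw [map_mul] at this
    change _ * constantCoeff eulerFunction = _ at this
    rw [h0, mul_zero, map_one] at this
    exact zero_ne_one this
  exact ((PowerSeries.eq_inv_iff_mul_eq_one hc).2 h5).symm

/-! ### The blocks -/

/-- The level-`n` coefficient of the light block. -/
def lightCoeff (Δ h : ℂ) (n : ℕ) : ℂ :=
  ∑ M : n.Partition,
    lightVal (fieldOp Δ) h ((M.parts.sort (· ≥ ·)).count 1) ((M.parts.sort (· ≥ ·)).count 1) 0 /
      lightVal (fun _ => 0) h ((M.parts.sort (· ≥ ·)).count 1) ((M.parts.sort (· ≥ ·)).count 1) 0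

theorem tendsto_blockCoeff_light (Δ : ℂ) {n : ℕ} {h : ℂ} (hh : ∀ k < n, 2 * h ≠ -(k : ℂ)) :
    (∀ᶠ c in cobounded ℂ, IsUnit (gram c h n).det) ∧
      Tendsto (fun c => blockCoeff Δ h c n) (cobounded ℂ) (𝓝 (lightCoeff Δ h n)) := by
  refine (heavyLight_light h).tendsto_blockCoeff ?_ Δ
    (fun M => (M.parts.sort (· ≥ ·)).filter (2 ≤ ·))
    (fun M => List.replicate ((M.parts.sort (· ≥ ·)).count 1) 1) sort_split
    (fun M N => partition_ext_of_perm_filter) ?_ (fun M => ⟨_, rfl⟩)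
    (fun M N => lightVal (fun _ => 0) h ((M.parts.sort (· ≥ ·)).count 1)
      ((N.parts.sort (· ≥ ·)).count 1) 0)
    (fun M N => lightVal (fieldOp Δ) h ((M.parts.sort (· ≥ ·)).count 1)
      ((N.parts.sort (· ≥ ·)).count 1) 0) ?_ ?_ ?_
  · intro m hm
    have h1 : (m : ℂ) ≠ 0 := Nat.cast_ne_zero.2 (by omega)
    have h2 : (m : ℂ) ^ 2 - 1 ≠ 0 := by
      rw [sub_ne_zero]
      have : m ^ 2 ≠ 1 := by nlinarith
      exact_mod_cast this
    exact div_ne_zero (mul_ne_zero h1 h2) (by norm_num)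
  · intro M m hm
    simpa using (List.mem_filter.1 hm).2
  · intro M N
    simp only [ward_light _ _ (gramLaurent_spec _ h)]
    exact tendsto_const_nhds
  · intro M N
    simp only [ward_light _ _ (primaryForm_spec Δ _ h)]
    exact tendsto_const_nhds
  · intro M
    exact lightVal_gram_ne_zero fun i hi => hh i (hi.trans_le (count_one_le M))

/-- `limUnder` is meaningful only once convergence is known, hence the condition on `h`. -/
theorem coeff_lightBlock (Δ : ℂ) {n : ℕ} {h : ℂ} (hh : ∀ k < n, 2 * h ≠ -(k : ℂ)) :
    coeff n (lightBlock Δ h) = lightCoeff Δ h n := by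
  rw [lightBlock, coeff_mk]
  simp only [torusBlock, coeff_mk]
  exact (tendsto_blockCoeff_light Δ hh).2.limUnder_eq

theorem tendsto_lightCoeff (Δ : ℂ) (n : ℕ) :
    Tendsto (fun h => lightCoeff Δ h n) (cobounded ℂ) (𝓝 (Fintype.card n.Partition : ℂ)) := by
  have e : (Fintype.card n.Partition : ℂ) = ∑ _M : n.Partition, (1 : ℂ) := by
    simp [Finset.card_univ]
  rw [e]
  refine tendsto_finsetSum _ fun M _ => ?_
  set k := (M.parts.sort (· ≥ ·)).count 1
  have hne : (2 ^ k * k.factorial : ℂ) ≠ 0 :=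
    mul_ne_zero (pow_ne_zero _ two_ne_zero) (Nat.cast_ne_zero.2 k.factorial_ne_zero)
  have h1 := (tendsto_lightVal_self (fieldOp_apply Δ) k).div
    (tendsto_lightVal_self (D := fun _ => 0) (γ := fun _ _ => 0) (by simp) k) hne
  rw [div_self hne] at h1
  refine h1.congr' ?_
  filter_upwards [eventually_ne_cobounded (0 : ℂ)] with h hh
  exact div_div_div_cancel_right₀ (pow_ne_zero _ hh) _ _

theorem tendsto_blockCoeff_heavy (Δ : ℂ) {ε : ℂ}
    (hε : ∀ m : ℕ, 1 ≤ m → 24 * ε ≠ 1 - (m : ℂ) ^ 2) (n : ℕ) :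
    (∀ᶠ c in cobounded ℂ, IsUnit (gram c (c * ε) n).det) ∧
      Tendsto (fun c => blockCoeff Δ (c * ε) c n) (cobounded ℂ)
        (𝓝 (Fintype.card n.Partition : ℂ)) := by
  have e : (Fintype.card n.Partition : ℂ) = ∑ _M : n.Partition, (1 : ℂ) / 1 := by
    simp [Finset.card_univ]
  rw [e]
  refine (heavyLight_heavy ε).tendsto_blockCoeff ?_ Δ (fun M => M.parts.sort (· ≥ ·))
    (fun _ => []) (fun M => (List.append_nil _).symm) (fun M N => partition_ext_of_perm_sort)
    (fun M m hm => M.parts_pos ((Multiset.mem_sort _).1 hm)) (fun _ => rfl)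
    (fun _ _ => 1) (fun _ _ => 1) ?_ ?_ (fun _ => one_ne_zero)
  · intro m hm h0
    have h1 : (m : ℂ) ≠ 0 := Nat.cast_ne_zero.2 (by omega)
    apply hε m hm
    -- The left side is `12 κ_m`, so the excluded values of `ε` are exactly the zeros of `κ_m` for
    -- `m ≥ 1`.
    have h2 : (m : ℂ) * (24 * ε - (1 - (m : ℂ) ^ 2)) = 0 := by linear_combination 12 * h0
    exact sub_eq_zero.1 ((mul_eq_zero.1 h2).resolve_left h1)
  · intro M N
    have : ∀ c, gramLaurent c (c * ε) (descendant c (c * ε) []) (descendant c (c * ε) []) 0 = 1 :=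
      fun c => by
        change gramLaurent c (c * ε) (vac _ _) (vac _ _) 0 = 1
        rw [(gramLaurent_spec c (c * ε)).1, Finsupp.single_eq_same]
    simp only [this]
    exact tendsto_const_nhds
  · intro M N
    have : ∀ c, primaryForm Δ c (c * ε) (descendant c (c * ε) []) (descendant c (c * ε) []) 0 = 1 :=
      fun c => by
        change primaryForm Δ c (c * ε) (vac _ _) (vac _ _) 0 = 1
        rw [(primaryForm_spec Δ c (c * ε)).1, Finsupp.single_eq_same]
    simp only [this]
    exact tendsto_const_nhds

theorem heavyLightBlock_eq (Δ : ℂ) {ε : ℂ} (hε : ∀ m : ℕ, 1 ≤ m → 24 * ε ≠ 1 - (m : ℂ) ^ 2) :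
    heavyLightBlock Δ ε = PowerSeries.mk fun n => (Fintype.card n.Partition : ℂ) := by
  rw [heavyLightBlock]
  congr 1
  funext n
  simp only [torusBlock, coeff_mk]
  exact (tendsto_blockCoeff_heavy Δ hε n).2.limUnder_eq

end Virasoro

end

/-- Heavy-light, light torus blocks and the Euler function. Limits of power series are
coefficientwise; `Δ`, the exchanged dimension `h` and the central charge `c` are complex and
`c → ∞`, `h → ∞` mean `|c| → ∞`, `|h| → ∞`. -/
theorem proposition4p1 (Δ : ℂ) :
    -- the light block exists: its level-`n` coefficient is a limit of well-defined coefficients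
    (∀ (n : ℕ) (h : ℂ), (∀ k : ℕ, k < n → 2 * h ≠ -(k : ℂ)) →
      (∀ᶠ c in cobounded ℂ, IsUnit (Virasoro.gram c h n).det) ∧
      Tendsto (fun c => coeff n (Virasoro.torusBlock Δ h c)) (cobounded ℂ)
        (𝓝 (coeff n (Virasoro.lightBlock Δ h)))) ∧
    ∀ ε : ℂ, (∀ m : ℕ, 1 ≤ m → 24 * ε ≠ 1 - (m : ℂ) ^ 2) →
      -- the heavy-light block exists
      (∀ n : ℕ, ∀ᶠ c in cobounded ℂ, IsUnit (Virasoro.gram c (c * ε) n).det) ∧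
      Tendsto (fun c => Virasoro.torusBlock Δ (c * ε) c) (cobounded ℂ)
        (𝓝 (Virasoro.heavyLightBlock Δ ε)) ∧
      -- it is the limit of the light block
      Tendsto (fun h => Virasoro.lightBlock Δ h) (cobounded ℂ)
        (𝓝 (Virasoro.heavyLightBlock Δ ε)) ∧
      -- it is the inverse Euler function
      Virasoro.heavyLightBlock Δ ε = (Virasoro.eulerFunction)⁻¹ := by
  refine ⟨fun n h hh => ⟨(Virasoro.tendsto_blockCoeff_light Δ hh).1, ?_⟩, fun ε hε =>
    ⟨fun n => (Virasoro.tendsto_blockCoeff_heavy Δ hε n).1, ?_, ?_, ?_⟩⟩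
  · rw [Virasoro.coeff_lightBlock Δ hh]
    simp only [Virasoro.torusBlock, coeff_mk]
    exact (Virasoro.tendsto_blockCoeff_light Δ hh).2
  · rw [Virasoro.heavyLightBlock_eq Δ hε, PowerSeries.WithPiTopology.tendsto_iff_coeff_tendsto]
    intro n
    simp only [Virasoro.torusBlock, coeff_mk]
    exact (Virasoro.tendsto_blockCoeff_heavy Δ hε n).2
  · rw [Virasoro.heavyLightBlock_eq Δ hε, PowerSeries.WithPiTopology.tendsto_iff_coeff_tendsto]
    intro n
    rw [coeff_mk]
    refine (Virasoro.tendsto_lightCoeff Δ n).congr' ?_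
    -- For a fixed coefficient only finitely many `h` are exceptional. Their number grows with `n`,
    -- but coefficientwise convergence does not need uniformity.
    have hne : ∀ᶠ h : ℂ in cobounded ℂ, ∀ k ∈ Finset.range n, h ≠ -(k : ℂ) / 2 :=
      (Filter.eventually_all_finset _).2 fun k _ => eventually_ne_cobounded _
    filter_upwards [hne] with h hh
    refine (Virasoro.coeff_lightBlock Δ fun k hk e => hh k (Finset.mem_range.2 hk) ?_).symm
    rw [← e]
    ring
  · rw [Virasoro.heavyLightBlock_eq Δ hε, Virasoro.inv_eulerFunction]
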